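/- Let $D=(G,\alpha)$ be a graph-like ZX-diagram with no inputs and outputs: $G=(V,E)$ is a finite simple undirected graph, each $v\in V$ is a Z-spider with phase $\alpha_v\in[0,2\pi)$, and each edge is a Hadamard edge. Contracting $D$ means computing the scalar that $D$ represents as a tensor network, where a Z-spider with phase $a$ is the tensor $|0\cdots0\rangle+e^{ia}|1\cdots1\rangle$ and a Hadamard edge is the matrix $\frac1{\sqrt2}\begin{pmatrix}1&1\\1&-1\end{pmatrix}$. A rank-decomposition $T=(V_T,E_T)$ of $G$ is a tree whose non-leaf nodes all have degree $3$, with a bijection from $V$ to its leaves (the node of a one-node tree counts as a leaf). An edge $uv$ of $T$ carries the cut-rank $\rho_{u,v}$, that is, the rank over $\mathbb F_2$ of the adjacency matrix of $G$ between $X$ and $V\setminus X$, where $X$ is the set of vertices whose leaves lie in the component of $u$ after deleting $uv$. The width $R$ of $T$ is the maximum of $\rho_{u,v}$ over the edges of $T$ ($0$ if there are none). $T$ is linear if its non-leaf nodes form a (possibly empty) path. For $v\in V_T$ with three neighbours $u_1,u_2,u_3$ put $w_v=\min(\rho_{v,u_1}+\rho_{v,u_2},\rho_{v,u_1}+\rho_{v,u_3},\rho_{v,u_2}+\rho_{v,u_3})$,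 and put $w_v=0$ if $v$ is a leaf. If $T$ is a linear rank-decomposition of $G$ of width $R$, then $w_v\le R+1$ for every $v\in V_T$. Moreover there is an algorithm which, given any such $D$ and any linear rank-decomposition $T$ of $G$, contracts $D$ in $\tilde O(2^R)$ time, where $R$ is the width of $T$. Here $\tilde O$ hides a factor polynomial in $|V|$: there are a single program and absolute constants $c,k$ such that the running time is at most $c\,|V|^k\,2^R$ for all inputs. Time is counted on a random access machine that performs exact arithmetic operations on complex numbers ($+,-,\times$, the constants $0$, $1$, $1/\sqrt2$, and the factors $e^{i\alpha_v}$ of the input) in one step each, charges operations on natural numbers the bit length of the numbers involved, and determines control flow and addresses by natural numbers only. -/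

import Mathlib

namespace ZX

noncomputable section

/-! ### Cut-rank and rank-decompositions -/

open Classical in
/-- The cut-rank of `X` in the graph `G`: the rank over the two-element field of the
adjacency matrix between `X` and its complement. -/
def cutRank {V : Type*} [Fintype V] (G : SimpleGraph V) (X : Set V) : ℕ :=
  ((G.adjMatrix (ZMod 2)).submatrix
    (fun i : X => (i : V)) (fun j : (Xᶜ : Set V) => (j : V))).rank

/-- A leaf of a tree: a node with at most one neighbour (the only node of a one-node tree
counts as a leaf). -/
def IsLeaf {W : Type*} (T : SimpleGraph W) (v : W) : Prop :=
  (T.neighborSet v).ncard ≤ 1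

/-- A branch-decomposition of the ground set `M` whose tree has node set `W`: a tree in which
every non-leaf node has degree 3, and a bijection from `M` to the leaves. Together with a graph
on `M`, which determines the cut-rank of every tree edge, it is a rank-decomposition. -/
structure BranchDecomposition (M W : Type*) where
  tree : SimpleGraph W
  isTree : tree.IsTree
  degree_eq_three : ∀ v, ¬ IsLeaf tree v → (tree.neighborSet v).ncard = 3
  leafEquiv : M ≃ {v : W // IsLeaf tree v}

namespace BranchDecomposition

variable {V W : Type*} (T : BranchDecomposition V W)

/-- The elements of the ground set whose leaves lie in the component of `u` after the edge
between `u` and `v` has been deleted from the tree. -/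
def side (u v : W) : Set V :=
  {x | (T.tree.deleteEdges {s(u, v)}).Reachable u (T.leafEquiv x : W)}

/-- The cut-rank `ρ_{u,v}` assigned to the tree edge between `u` and `v`. -/
def edgeRank [Fintype V] (G : SimpleGraph V) (u v : W) : ℕ :=
  cutRank G (T.side u v)

open Classical in
/-- The width: the maximum of the cut-ranks of the tree edges (0 if there is no edge). -/
def width [Fintype V] [Fintype W] (G : SimpleGraph V) : ℕ :=
  Finset.univ.sup fun d : T.tree.Dart => T.edgeRank G d.fst d.snd

/-- The decomposition is linear: the non-leaf nodes of the tree form a (possibly empty) path. -/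
def IsLinear : Prop :=
  ∃ k : ℕ, Nonempty (T.tree.induce {v | ¬ IsLeaf T.tree v} ≃g SimpleGraph.pathGraph k)

open Classical in
/-- The exponent `w_v`: the least sum of the cut-ranks of two distinct tree edges at `v` if `v`
has three neighbours, and 0 if `v` is a leaf. -/
def nodeWeight [Fintype V] (G : SimpleGraph V) (v : W) : ℕ :=
  if IsLeaf T.tree v then 0
  else sInf {s | ∃ u₁ u₂, T.tree.Adj v u₁ ∧ T.tree.Adj v u₂ ∧ u₁ ≠ u₂ ∧
    s = T.edgeRank G v u₁ + T.edgeRank G v u₂}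

end BranchDecomposition

/-! ### Graph-like ZX-diagrams without inputs and outputs -/

/-- A closed graph-like ZX-diagram with spiders `0, …, n - 1`: all spiders are Z-spiders, and
the connections are Hadamard edges, at most one between two distinct spiders. -/
structure Diagram (n : ℕ) where
  graph : SimpleGraph (Fin n)
  phase : Fin n → ℝ
  phase_mem : ∀ v, phase v ∈ Set.Ico 0 (2 * Real.pi)

open Classical in
/-- The tensor of the Z-spider with phase `a` and legs `L`: `|0…0⟩ + e^{ia} |1…1⟩`. -/
def zSpider {L : Type*} (a : ℝ) (x : L → Bool) : ℂ :=
  (if ∀ l, x l = false then 1 else 0) +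
    Complex.exp (Complex.I * a) * (if ∀ l, x l = true then 1 else 0)

/-- The entries of the Hadamard gate. -/
def hadamard (a b : Bool) : ℂ :=
  (if a && b then -1 else 1) * ((Real.sqrt 2 : ℝ) : ℂ)⁻¹

open Classical in
/-- The scalar represented by the diagram, as a tensor network: every edge has two ends, which are
its two orientations (darts); the product of the spider tensors and of one Hadamard gate per edge
is summed over all assignments of bits to the ends. -/
def Diagram.value {n : ℕ} (D : Diagram n) : ℂ :=
  ∑ x : D.graph.Dart → Bool,
    (∏ v : Fin n, zSpider (D.phase v) (fun l : {d : D.graph.Dart // d.fst = v} => x l)) *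
      ∏ d : D.graph.Dart with d.fst < d.snd, hadamard (x d) (x d.symm)

/-! ### The machine model

A random access machine with natural-number memory and complex memory. A program is a finite text
which does not depend on the input. Operations on natural numbers are charged the bit length of the
numbers involved (logarithmic cost), and every arithmetic operation on complex numbers
is charged one step. Control flow and addresses depend on natural numbers only. -/

/-- The memory: natural-number variables, natural-number arrays and complex arrays (a program names
only finitely many of them), and the phases of the input, which can only be read. -/
structure Memory where
  nvar : ℕ → ℕ
  narr : ℕ → ℕ → ℕ
  carr : ℕ → ℕ → ℂ
  phase : ℕ → ℝ

/-- Expressions with natural-number values. -/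
inductive NExpr where
  | const (k : ℕ)
  | var (i : ℕ)
  | read (a : ℕ) (e : NExpr)
  | add (e f : NExpr)
  | sub (e f : NExpr)
  | mul (e f : NExpr)
  | div (e f : NExpr)
  | mod (e f : NExpr)

/-- The value of an expression; subtraction is truncated, division rounds down. -/
def NExpr.eval (s : Memory) : NExpr → ℕ
  | const k => k
  | var i => s.nvar i
  | read a e => s.narr a (e.eval s)
  | add e f => e.eval s + f.eval s
  | sub e f => e.eval s - f.eval s
  | mul e f => e.eval s * f.eval s
  | div e f => e.eval s / f.eval s
  | mod e f => e.eval s % f.eval s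

/-- The cost of evaluating an expression: for every subexpression, one step and the bit length of
its value. -/
def NExpr.cost (s : Memory) : NExpr → ℕ
  | const k => 1 + k.size
  | var i => 1 + (s.nvar i).size
  | read a e => 1 + (s.narr a (e.eval s)).size + e.cost s
  | add e f => 1 + (e.eval s + f.eval s).size + e.cost s + f.cost s
  | sub e f => 1 + (e.eval s - f.eval s).size + e.cost s + f.cost s
  | mul e f => 1 + (e.eval s * f.eval s).size + e.cost s + f.cost s
  | div e f => 1 + (e.eval s / f.eval s).size + e.cost s + f.cost s
  | mod e f => 1 + (e.eval s % f.eval s).size + e.cost s + f.cost s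

/-- Expressions with complex values. -/
inductive CExpr where
  | zero
  | one
  | invSqrtTwo
  | phaseFactor (e : NExpr)
  | read (a : ℕ) (e : NExpr)
  | add (x y : CExpr)
  | sub (x y : CExpr)
  | mul (x y : CExpr)

/-- The value of a complex expression; `phaseFactor e` is `e^{iα}` for the phase `α` of the
spider whose number is the value of `e`. -/
def CExpr.eval (s : Memory) : CExpr → ℂ
  | zero => 0
  | one => 1
  | invSqrtTwo => ((Real.sqrt 2 : ℝ) : ℂ)⁻¹
  | phaseFactor e => Complex.exp (Complex.I * s.phase (e.eval s))
  | read a e => s.carr a (e.eval s)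
  | add x y => x.eval s + y.eval s
  | sub x y => x.eval s - y.eval s
  | mul x y => x.eval s * y.eval s

/-- The cost of evaluating a complex expression: one step for every subexpression, and the cost of
the addresses. -/
def CExpr.cost (s : Memory) : CExpr → ℕ
  | zero => 1
  | one => 1
  | invSqrtTwo => 1
  | phaseFactor e => 1 + e.cost s
  | read _ e => 1 + e.cost s
  | add x y => 1 + x.cost s + y.cost s
  | sub x y => 1 + x.cost s + y.cost s
  | mul x y => 1 + x.cost s + y.cost s

/-- Programs. A condition counts as true if its value is not 0. -/
inductive Program where
  | skip
  | assign (i : ℕ) (e : NExpr)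
  | nstore (a : ℕ) (i e : NExpr)
  | cstore (a : ℕ) (i : NExpr) (x : CExpr)
  | seq (p q : Program)
  | branch (e : NExpr) (p q : Program)
  | loop (e : NExpr) (p : Program)

/-- `Runs p s s' t`: started with memory `s`, the program `p` halts with memory `s'` after
`t` steps. -/
inductive Runs : Program → Memory → Memory → ℕ → Prop where
  | skip (s : Memory) : Runs .skip s s 1
  | assign (i : ℕ) (e : NExpr) (s : Memory) :
      Runs (.assign i e) s { s with nvar := Function.update s.nvar i (e.eval s) } (1 + e.cost s)
  | nstore (a : ℕ) (i e : NExpr) (s : Memory) :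
      Runs (.nstore a i e) s
        { s with narr :=
            Function.update s.narr a (Function.update (s.narr a) (i.eval s) (e.eval s)) }
        (1 + i.cost s + e.cost s)
  | cstore (a : ℕ) (i : NExpr) (x : CExpr) (s : Memory) :
      Runs (.cstore a i x) s
        { s with carr :=
            Function.update s.carr a (Function.update (s.carr a) (i.eval s) (x.eval s)) }
        (1 + i.cost s + x.cost s)
  | seq {p q : Program} {s s₁ s₂ : Memory} {t₁ t₂ : ℕ} :
      Runs p s s₁ t₁ → Runs q s₁ s₂ t₂ → Runs (.seq p q) s s₂ (t₁ + t₂)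
  | branch_true {e : NExpr} {p q : Program} {s s₁ : Memory} {t : ℕ} :
      e.eval s ≠ 0 → Runs p s s₁ t → Runs (.branch e p q) s s₁ (1 + e.cost s + t)
  | branch_false {e : NExpr} {p q : Program} {s s₁ : Memory} {t : ℕ} :
      e.eval s = 0 → Runs q s s₁ t → Runs (.branch e p q) s s₁ (1 + e.cost s + t)
  | loop_true {e : NExpr} {p : Program} {s s₁ s₂ : Memory} {t₁ t₂ : ℕ} :
      e.eval s ≠ 0 → Runs p s s₁ t₁ → Runs (.loop e p) s₁ s₂ t₂ →
        Runs (.loop e p) s s₂ (1 + e.cost s + t₁ + t₂)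
  | loop_false {e : NExpr} {p : Program} {s : Memory} :
      e.eval s = 0 → Runs (.loop e p) s s (1 + e.cost s)

open Classical in
/-- The initial memory for a diagram with `n` spiders and a decomposition whose tree has `m` nodes.
Variables 0 and 1 hold `n` and `m`; arrays 0 and 1 hold the adjacency matrices of the graph
and of the tree, row by row; array 2 holds the leaf of every spider; everything else is 0. -/
def inputMemory {n m : ℕ} (D : Diagram n) (T : BranchDecomposition (Fin n) (Fin m)) : Memory where
  nvar := fun i => if i = 0 then n else if i = 1 then m else 0
  narr := fun a i =>
    if a = 0 then
      if ∃ u v : Fin n, i = u * n + v ∧ D.graph.Adj u v then 1 else 0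
    else if a = 1 then
      if ∃ u v : Fin m, i = u * m + v ∧ T.tree.Adj u v then 1 else 0
    else if a = 2 then
      if h : i < n then ((T.leafEquiv ⟨i, h⟩ : Fin m) : ℕ) else 0
    else 0
  carr := fun _ _ => 0
  phase := fun i => if h : i < n then D.phase ⟨i, h⟩ else 0

/-- The result of a computation is left in the first cell of complex array 0. -/
def Memory.output (s : Memory) : ℂ := s.carr 0 0

/-- On the diagram `D` and the decomposition `T`, the program halts after at most `B` steps, and its
output is the scalar represented by `D`. -/
def Program.Contracts {n m : ℕ} (P : Program) (D : Diagram n)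
    (T : BranchDecomposition (Fin n) (Fin m)) (B : ℕ) : Prop :=
  ∃ (s : Memory) (t : ℕ), Runs P (inputMemory D T) s t ∧ s.output = D.value ∧ t ≤ B

end

end ZX

/-! Bound on `w_v`: in a linear decomposition an inner node has degree 3 but at most two neighbours
on the path of inner nodes, so one neighbour is a leaf. The edge to a leaf cuts off a single vertex
and has cut-rank at most 1; any other edge at the node has cut-rank at most R.

Contraction: a Z-spider forces one common bit on all its legs. Hence the scalar is the product of
the factors 1/√2 times a sum over the sets Z of spiders with bit 1, where Z contributes its phase
factors and a sign for each edge inside Z (`Diagram.value_eq`). The spiders are summed out one at a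
time; let X be the set of those already treated. A subset Z of X affects the later factors only
through its key, the parities of the numbers of neighbours in Z of the vertices outside X. So it
suffices to keep, for every key that occurs, the sum of the weights of the subsets with that key;
`table_insert` is the resulting recursion.

Number of keys: the keys encode the row space of the cut matrix of X, so there are at most 2 to the
cut-rank of X (`card_keys_le_two_pow_cutRank`). When the spiders are taken in the order of the path
of inner nodes, X is one side of a tree edge whenever a new node is reached (`IsSpine.side_eq`),
which leaves at most 2^R keys. A node carries at most three leaves and a spider at most doubles the
number of keys, so there are never more than 8 * 2^R.

Time: tables are addressed directly by the key. The address range is exponential in n, but memory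
starts as zero and each level has its own cells, so nothing has to be cleared; a list of the keys
present makes a pass over a table as long as the number of keys. All natural numbers have at most
2n+1 bits, so one instruction costs O(n). `Ex` is a Hoare triple with a time bound, and
`Instance.Layout` is all that the analysis of the program needs to know about the path. -/

namespace ZX

/-! ### A program logic with time bounds -/

/-- A bound for the bit length of the value of an expression, in units of the bit length of
the memory contents. -/
def NExpr.sizeFactor : NExpr → ℕ
  | const k => k + 1
  | var _ => 1
  | read _ _ => 1
  | add e f | sub e f | mul e f | div e f | mod e f => e.sizeFactor + f.sizeFactor + 1

/-- A bound for the cost of an expression, in units of the bit length of the memory contents. -/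
def NExpr.costFactor : NExpr → ℕ
  | const k => k + 2
  | var _ => 2
  | read _ e => 2 + e.costFactor
  | add e f | sub e f | mul e f | div e f | mod e f =>
      e.sizeFactor + f.sizeFactor + 2 + e.costFactor + f.costFactor

/-- A bound for the cost of a complex expression, in units of the bit length of the memory
contents. -/
def CExpr.costFactor : CExpr → ℕ
  | zero | one | invSqrtTwo => 1
  | phaseFactor e => 1 + e.costFactor
  | read _ e => 1 + e.costFactor
  | add x y | sub x y | mul x y => 1 + x.costFactor + y.costFactor

/-- All natural numbers in the memory have at most `M` bits. -/
structure Memory.Small (M : ℕ) (s : Memory) : Prop where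
  nvar : ∀ i, s.nvar i < 2 ^ M
  narr : ∀ a i, s.narr a i < 2 ^ M

/-- Bit lengths add up under multiplication, the extra 1 in `sizeFactor` absorbs the carry of an
addition, and the other operations do not increase their first argument. A fixed expression thus has
O(M) bits. -/
theorem NExpr.size_eval_le {M : ℕ} (hM : 1 ≤ M) {s : Memory} (hs : s.Small M) (e : NExpr) :
    (e.eval s).size ≤ e.sizeFactor * M := by
  have mono : ∀ {a b : ℕ}, a ≤ b → a.size ≤ b.size := fun h => Nat.size_le_size h
  induction e with
  | const k =>
    have : k.size ≤ k := Nat.size_le.2 Nat.lt_two_pow_self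
    simp only [eval, sizeFactor]; nlinarith
  | var i => simpa [eval, sizeFactor] using Nat.size_le.2 (hs.nvar i)
  | read a e _ => simpa [eval, sizeFactor] using Nat.size_le.2 (hs.narr a _)
  | add e f he hf =>
    simp only [eval, sizeFactor]
    have h1 := Nat.size_le.1 he
    have h2 := Nat.size_le.1 hf
    apply Nat.size_le.2
    have h3 : 2 ^ (e.sizeFactor * M) ≤ 2 ^ (e.sizeFactor * M + f.sizeFactor * M) :=
      Nat.pow_le_pow_right (by norm_num) (by omega)
    have h4 : 2 ^ (f.sizeFactor * M) ≤ 2 ^ (e.sizeFactor * M + f.sizeFactor * M) :=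
      Nat.pow_le_pow_right (by norm_num) (by omega)
    have h5 : 2 ^ (e.sizeFactor * M + f.sizeFactor * M + 1)
        ≤ 2 ^ ((e.sizeFactor + f.sizeFactor + 1) * M) :=
      Nat.pow_le_pow_right (by norm_num) (by nlinarith)
    rw [pow_succ] at h5
    omega
  | sub e f he hf =>
    simp only [eval, sizeFactor]
    have := mono (Nat.sub_le (e.eval s) (f.eval s)); nlinarith
  | mul e f he hf =>
    simp only [eval, sizeFactor]
    have h1 := Nat.size_le.1 he
    have h2 := Nat.size_le.1 hf
    apply Nat.size_le.2
    have h5 : 2 ^ (e.sizeFactor * M + f.sizeFactor * M)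
        ≤ 2 ^ ((e.sizeFactor + f.sizeFactor + 1) * M) :=
      Nat.pow_le_pow_right (by norm_num) (by nlinarith)
    rw [pow_add] at h5
    exact (Nat.mul_lt_mul'' h1 h2).trans_le h5
  | div e f he hf =>
    simp only [eval, sizeFactor]
    have := mono (Nat.div_le_self (e.eval s) (f.eval s)); nlinarith
  | mod e f he hf =>
    simp only [eval, sizeFactor]
    have := mono (Nat.mod_le (e.eval s) (f.eval s)); nlinarith

theorem NExpr.cost_le {M : ℕ} (hM : 1 ≤ M) {s : Memory} (hs : s.Small M) (e : NExpr) :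
    e.cost s ≤ e.costFactor * M := by
  have key := fun e : NExpr => e.size_eval_le hM hs
  induction e with
  | const k => have := key (const k); simp only [eval, sizeFactor, cost, costFactor] at *; nlinarith
  | var i => have := key (var i); simp only [eval, sizeFactor, cost, costFactor] at *; nlinarith
  | read a e he =>
    have := key (read a e); simp only [eval, sizeFactor, cost, costFactor] at *; nlinarith
  | add e f he hf =>
    have := key (add e f); simp only [eval, sizeFactor, cost, costFactor] at *; nlinarith
  | sub e f he hf =>
    have := key (sub e f); simp only [eval, sizeFactor, cost, costFactor] at *; nlinarith
  | mul e f he hf =>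
    have := key (mul e f); simp only [eval, sizeFactor, cost, costFactor] at *; nlinarith
  | div e f he hf =>
    have := key (div e f); simp only [eval, sizeFactor, cost, costFactor] at *; nlinarith
  | mod e f he hf =>
    have := key (mod e f); simp only [eval, sizeFactor, cost, costFactor] at *; nlinarith

theorem CExpr.cost_le {M : ℕ} (hM : 1 ≤ M) {s : Memory} (hs : s.Small M) (x : CExpr) :
    x.cost s ≤ x.costFactor * M := by
  induction x with
  | zero | one | invSqrtTwo => simpa [cost, costFactor] using hM
  | phaseFactor e =>
    have := e.cost_le hM hs; simp only [cost, costFactor] at *; nlinarith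
  | read _ e =>
    have := e.cost_le hM hs; simp only [cost, costFactor] at *; nlinarith
  | add x y hx hy | sub x y hx hy | mul x y hx hy =>
    simp only [cost, costFactor] at *; nlinarith

/-- The natural-number variables assigned by a program. -/
def Program.writesVar : Program → ℕ → Bool
  | skip, _ => false
  | assign i _, j => i == j
  | nstore _ _ _, _ => false
  | cstore _ _ _, _ => false
  | seq p q, j => p.writesVar j || q.writesVar j
  | branch _ p q, j => p.writesVar j || q.writesVar j
  | loop _ p, j => p.writesVar j

/-- The natural-number arrays written by a program. -/
def Program.writesArr : Program → ℕ → Bool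
  | skip, _ => false
  | assign _ _, _ => false
  | nstore a _ _, j => a == j
  | cstore _ _ _, _ => false
  | seq p q, j => p.writesArr j || q.writesArr j
  | branch _ p q, j => p.writesArr j || q.writesArr j
  | loop _ p, j => p.writesArr j

/-- The complex arrays written by a program. -/
def Program.writesCArr : Program → ℕ → Bool
  | skip, _ => false
  | assign _ _, _ => false
  | nstore _ _ _, _ => false
  | cstore a _ _, j => a == j
  | seq p q, j => p.writesCArr j || q.writesCArr j
  | branch _ p q, j => p.writesCArr j || q.writesCArr j
  | loop _ p, j => p.writesCArr j

/-- The memories `s` and `s'` agree on everything that `P` does not write. -/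
structure Frame (P : Program) (s s' : Memory) : Prop where
  nvar : ∀ i, P.writesVar i = false → s'.nvar i = s.nvar i
  narr : ∀ a, P.writesArr a = false → s'.narr a = s.narr a
  carr : ∀ a, P.writesCArr a = false → s'.carr a = s.carr a
  phase : s'.phase = s.phase

theorem Frame.refl (P : Program) (s : Memory) : Frame P s s :=
  ⟨fun _ _ => rfl, fun _ _ => rfl, fun _ _ => rfl, rfl⟩

theorem Frame.mono {P Q : Program} {s s' : Memory} (h : Frame P s s')
    (h1 : ∀ i, Q.writesVar i = false → P.writesVar i = false)
    (h2 : ∀ i, Q.writesArr i = false → P.writesArr i = false)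
    (h3 : ∀ i, Q.writesCArr i = false → P.writesCArr i = false) : Frame Q s s' :=
  ⟨fun i hi => h.nvar i (h1 i hi), fun i hi => h.narr i (h2 i hi),
    fun i hi => h.carr i (h3 i hi), h.phase⟩

theorem Frame.trans {P : Program} {s s₁ s₂ : Memory} (h : Frame P s s₁) (h' : Frame P s₁ s₂) :
    Frame P s s₂ :=
  ⟨fun i hi => (h'.nvar i hi).trans (h.nvar i hi), fun i hi => (h'.narr i hi).trans (h.narr i hi),
    fun i hi => (h'.carr i hi).trans (h.carr i hi), h'.phase.trans h.phase⟩

/-- Variables and arrays are named by literals, so what a program may write can be computed from its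
text. The side conditions of all later framing steps are therefore closed by `rfl` or `decide`. -/
theorem Runs.frame {P : Program} {s s' : Memory} {t : ℕ} (h : Runs P s s' t) : Frame P s s' := by
  induction h with
  | skip s => exact Frame.refl _ _
  | assign i e s =>
    refine ⟨fun j hj => ?_, fun _ _ => rfl, fun _ _ => rfl, rfl⟩
    have : j ≠ i := by rintro rfl; simp [Program.writesVar] at hj
    simp [this]
  | nstore a i e s =>
    refine ⟨fun _ _ => rfl, fun j hj => ?_, fun _ _ => rfl, rfl⟩
    have : j ≠ a := by rintro rfl; simp [Program.writesArr] at hj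
    simp [this]
  | cstore a i e s =>
    refine ⟨fun _ _ => rfl, fun _ _ => rfl, fun j hj => ?_, rfl⟩
    have : j ≠ a := by rintro rfl; simp [Program.writesCArr] at hj
    simp [this]
  | seq _ _ h1 h2 =>
    refine (h1.mono ?_ ?_ ?_).trans (h2.mono ?_ ?_ ?_) <;>
      simp +contextual [Program.writesVar, Program.writesArr, Program.writesCArr]
  | branch_true _ _ h1 =>
    refine h1.mono ?_ ?_ ?_ <;>
      simp +contextual [Program.writesVar, Program.writesArr, Program.writesCArr]
  | branch_false _ _ h1 =>
    refine h1.mono ?_ ?_ ?_ <;>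
      simp +contextual [Program.writesVar, Program.writesArr, Program.writesCArr]
  | loop_true _ _ _ h1 h2 =>
    refine Frame.trans (Frame.mono h1 ?_ ?_ ?_) h2 <;> exact fun _ h => h
  | loop_false _ => exact Frame.refl _ _

/-- Started in `s`, a memory of numbers with at most `M` bits, the program `P` halts within
`B * (1000 * M)` steps in a memory that satisfies `Q`, and the numbers in memory
still have at most `M` bits. -/
def Ex (M : ℕ) (P : Program) (s : Memory) (B : ℕ) (Q : Memory → Prop) : Prop :=
  s.Small M → ∃ s' t, Runs P s s' t ∧ t ≤ B * (1000 * M) ∧ s'.Small M ∧ Q s'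

namespace Ex

variable {M : ℕ} {P p q : Program} {s : Memory} {B B₁ B₂ : ℕ} {Q Q₁ : Memory → Prop}

theorem mono (h : Ex M P s B Q) {B' : ℕ} {Q' : Memory → Prop} (hB : B ≤ B')
    (hQ : ∀ s', Frame P s s' → Q s' → Q' s') : Ex M P s B' Q' := by
  intro hs
  obtain ⟨s', t, hr, ht, hs', hq⟩ := h hs
  exact ⟨s', t, hr, ht.trans (Nat.mul_le_mul_right _ hB), hs', hQ s' hr.frame hq⟩

theorem with_small (h : s.Small M → Ex M P s B Q) : Ex M P s B Q := fun hs => h hs hs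

theorem seq (h₁ : Ex M p s B₁ Q₁) (h₂ : ∀ s₁, Frame p s s₁ → Q₁ s₁ → Ex M q s₁ B₂ Q) :
    Ex M (.seq p q) s (B₁ + B₂) Q := by
  intro hs
  obtain ⟨s₁, t₁, hr₁, ht₁, hs₁, hq₁⟩ := h₁ hs
  obtain ⟨s₂, t₂, hr₂, ht₂, hs₂, hq₂⟩ := h₂ s₁ hr₁.frame hq₁ hs₁
  exact ⟨s₂, _, .seq hr₁ hr₂, by rw [add_mul]; omega, hs₂, hq₂⟩

theorem skip (hM : 1 ≤ M) (hQ : Q s) : Ex M .skip s 1 Q :=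
  fun hs => ⟨s, 1, .skip s, by omega, hs, hQ⟩

/-- The unit `1000 * M` of `Ex` is chosen so that an instruction costs one unit: the expressions
account for at most `999 * M` steps, and one step is charged for the instruction itself. -/
theorem assign (hM : 1 ≤ M) {i : ℕ} {e : NExpr} (he : e.eval s < 2 ^ M)
    (hc : e.costFactor ≤ 999) : Ex M (.assign i e) s 1 (fun s' => s'.nvar i = e.eval s) := by
  intro hs
  refine ⟨_, _, .assign i e s, ?_, ⟨fun j => ?_, hs.narr⟩, by simp⟩
  · have := e.cost_le hM hs
    nlinarith
  · by_cases h : j = i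
    · subst h; simpa using he
    · simpa [h] using hs.nvar j

theorem nstore (hM : 1 ≤ M) {a : ℕ} {i e : NExpr} (he : e.eval s < 2 ^ M)
    (hc : i.costFactor + e.costFactor ≤ 999) :
    Ex M (.nstore a i e) s 1
      (fun s' => s'.narr a = Function.update (s.narr a) (i.eval s) (e.eval s)) := by
  intro hs
  refine ⟨_, _, .nstore a i e s, ?_, ⟨hs.nvar, fun b j => ?_⟩, by simp⟩
  · have := e.cost_le hM hs
    have := i.cost_le hM hs
    nlinarith
  · by_cases h : b = a
    · subst h
      by_cases h' : j = i.eval s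
      · subst h'; simpa using he
      · simpa [h'] using hs.narr b j
    · simpa [h] using hs.narr b j

theorem cstore (hM : 1 ≤ M) {a : ℕ} {i : NExpr} {x : CExpr}
    (hc : i.costFactor + x.costFactor ≤ 999) :
    Ex M (.cstore a i x) s 1
      (fun s' => s'.carr a = Function.update (s.carr a) (i.eval s) (x.eval s)) := by
  intro hs
  refine ⟨_, _, .cstore a i x s, ?_, ⟨hs.nvar, hs.narr⟩, by simp⟩
  have := x.cost_le hM hs
  have := i.cost_le hM hs
  nlinarith

theorem branch (hM : 1 ≤ M) {e : NExpr} (hc : e.costFactor ≤ 999)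
    (h₁ : e.eval s ≠ 0 → Ex M p s B Q) (h₂ : e.eval s = 0 → Ex M q s B Q) :
    Ex M (.branch e p q) s (B + 1) Q := by
  intro hs
  have := e.cost_le hM hs
  by_cases h : e.eval s = 0
  · obtain ⟨s', t, hr, ht, hs', hq⟩ := h₂ h hs
    exact ⟨s', _, .branch_false h hr, by nlinarith, hs', hq⟩
  · obtain ⟨s', t, hr, ht, hs', hq⟩ := h₁ h hs
    exact ⟨s', _, .branch_true h hr, by nlinarith, hs', hq⟩

/-- The index of the invariant counts the rounds. A round is possible only for `j < N`, so `N`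
bounds their number and termination needs no separate variant. -/
theorem loop (hM : 1 ≤ M) {e : NExpr} (hc : e.costFactor ≤ 999) (N : ℕ) (I : ℕ → Memory → Prop)
    (h0 : I 0 s)
    (hstep : ∀ j s₁, Frame p s s₁ → I j s₁ → e.eval s₁ ≠ 0 → j < N ∧ Ex M p s₁ B (I (j + 1))) :
    Ex M (.loop e p) s (N * (B + 1) + 1) (fun s' => ∃ j, I j s' ∧ e.eval s' = 0) := by
  -- Induction on the number `r` of rounds that may remain; for `r = 0` a true condition would
  -- contradict `j < N`.
  have main : ∀ r j s₁, N - j = r → Frame p s s₁ → I j s₁ →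
      Ex M (.loop e p) s₁ (r * (B + 1) + 1) (fun s' => ∃ j, I j s' ∧ e.eval s' = 0) := by
    intro r
    induction r with
    | zero =>
      intro j s₁ hr hF hI hs
      have hce := e.cost_le hM hs
      by_cases h : e.eval s₁ = 0
      · exact ⟨s₁, _, .loop_false h, by nlinarith, hs, j, hI, h⟩
      · have := (hstep j s₁ hF hI h).1
        omega
    | succ r ih =>
      intro j s₁ hr hF hI hs
      have hce := e.cost_le hM hs
      by_cases h : e.eval s₁ = 0
      · refine ⟨s₁, _, .loop_false h, ?_, hs, j, hI, h⟩
        calc 1 + e.cost s₁ ≤ 1 * (1000 * M) := by nlinarith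
          _ ≤ _ := Nat.mul_le_mul_right _ (by omega)
      · obtain ⟨s₂, t₁, hr₁, ht₁, hs₂, hq₂⟩ := (hstep j s₁ hF hI h).2 hs
        obtain ⟨s₃, t₂, hr₂, ht₂, hs₃, hq₃⟩ :=
          ih (j + 1) s₂ (by omega) (hF.trans hr₁.frame) hq₂ hs₂
        refine ⟨s₃, _, .loop_true h hr₁ hr₂, ?_, hs₃, hq₃⟩
        have : ((r + 1) * (B + 1) + 1) * (1000 * M)
          = (r * (B + 1) + 1) * (1000 * M) + B * (1000 * M) + 1000 * M := by ring
        rw [this]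
        nlinarith
  exact main _ 0 s rfl (Frame.refl _ _) h0 |>.mono (by simp) (fun _ _ h => h)

end Ex

/-- The loop in which the variable `i` runs through `0, …, N - 1`, where `N` is the value
of the variable `b`. -/
def Program.forLoop (i b : ℕ) (p : Program) : Program :=
  .seq (.assign i (.const 0))
    (.loop (.sub (.var b) (.var i)) (.seq p (.assign i (.add (.var i) (.const 1)))))

/-- The invariant must survive the increment of the loop variable, so it is required in every memory
that differs from the current one at most in variable `i`. The program `.assign i (.const 0)` only
serves to name this set of changes: a frame depends on what is written, not on the value. -/
theorem Ex.forLoop {M : ℕ} {p : Program} {s : Memory} {B : ℕ} (hM : 1 ≤ M) {i b : ℕ} {N : ℕ}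
    (hN : s.nvar b = N) (I : ℕ → Memory → Prop)
    (hib : i ≠ b) (hi : p.writesVar i = false) (hb : p.writesVar b = false)
    (h0 : ∀ s₁, Frame (.assign i (.const 0)) s s₁ → I 0 s₁)
    (hstep : ∀ j s₁, Frame (.forLoop i b p) s s₁ → j < N → s₁.nvar i = j → I j s₁ →
      Ex M p s₁ B (fun s₂ => ∀ s₃, Frame (.assign i (.const 0)) s₂ s₃ → I (j + 1) s₃)) :
    Ex M (.forLoop i b p) s (N * (B + 2) + 2) (I N) := by
  refine Ex.with_small fun hs => ?_
  have hNs : N < 2 ^ M := hN ▸ hs.nvar b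
  have hFbody : ∀ s₁ s₂, Frame (.seq p (.assign i (.add (.var i) (.const 1)))) s₁ s₂ →
      Frame (.forLoop i b p) s₁ s₂ := by
    intro s₁ s₂ h
    refine h.mono ?_ ?_ ?_ <;>
      simp +contextual [Program.writesVar, Program.writesArr, Program.writesCArr, Program.forLoop]
  have hFas : ∀ s₁ s₂, Frame (.assign i (.const 0)) s₁ s₂ → Frame (.forLoop i b p) s₁ s₂ := by
    intro s₁ s₂ h
    refine h.mono ?_ ?_ ?_ <;>
      simp +contextual [Program.writesVar, Program.writesArr, Program.writesCArr, Program.forLoop]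
  have hwb : (Program.forLoop i b p).writesVar b = false := by
    simp [Program.writesVar, Program.forLoop, hb, hib]
  -- The initial assignment, then `N` rounds of body, increment and test, then the failing test.
  have hB : N * (B + 2) + 2 = 1 + (N * (B + 1 + 1) + 1) := by ring
  rw [hB, Program.forLoop]
  refine Ex.seq (Ex.assign hM (by simp [NExpr.eval]) (by simp [NExpr.costFactor])) ?_
  intro s₁ hF hs₁
  simp only [NExpr.eval] at hs₁
  refine (Ex.loop hM (by simp [NExpr.costFactor, NExpr.sizeFactor]) N
    (fun j s' => I j s' ∧ s'.nvar i = j ∧ j ≤ N) ⟨h0 s₁ hF, hs₁, by simp⟩ ?_).mono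
      le_rfl ?_
  · rintro j s₂ hF₂ ⟨hI, hj, hjN⟩ hne
    have hF' := (hFas _ _ hF).trans (hFbody _ _ hF₂)
    have hbN : s₂.nvar b = N := (hF'.nvar b hwb).trans hN
    have hlt : j < N := by
      simp only [NExpr.eval, hj, hbN] at hne; omega
    refine ⟨hlt, (hstep j s₂ hF' hlt hj hI).seq fun s₃ hF₃ h₃ => ?_⟩
    have hi₃ : s₃.nvar i = j := (hF₃.nvar i hi).trans hj
    refine (Ex.assign hM (by simp only [NExpr.eval, hi₃]; omega)
      (by simp [NExpr.costFactor, NExpr.sizeFactor])).mono le_rfl ?_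
    intro s₄ hF₄ h₄
    simp only [NExpr.eval, hi₃] at h₄
    exact ⟨h₃ s₄ (hF₄.mono (fun _ h => h) (fun _ h => h) (fun _ h => h)), h₄, hlt⟩
  · rintro s₂ hF₂ ⟨j, ⟨hI, hj, hjN⟩, hz⟩
    have hF' := (hFas _ _ hF).trans
      (hFbody _ _ (hF₂.mono (fun _ h => h) (fun _ h => h) (fun _ h => h)))
    have hbN : s₂.nvar b = N := (hF'.nvar b hwb).trans hN
    simp only [NExpr.eval, hj, hbN] at hz
    have : j = N := by omega
    exact this ▸ hI

open Finset

/-! ### The sum over bit assignments, one spider at a time -/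

/-- The number with the binary digits `b 0, …, b (n - 1)`. -/
def packBits (n : ℕ) (b : ℕ → ℕ) : ℕ := ∑ i ∈ range n, 2 ^ i * b i

theorem packBits_succ (n : ℕ) (b : ℕ → ℕ) :
    packBits (n + 1) b = packBits n b + 2 ^ n * b n := sum_range_succ _ _

theorem packBits_congr {n : ℕ} {b b' : ℕ → ℕ} (h : ∀ i < n, b i = b' i) :
    packBits n b = packBits n b' :=
  sum_congr rfl fun i hi => by rw [h i (mem_range.1 hi)]

theorem packBits_lt (n : ℕ) {b : ℕ → ℕ} (hb : ∀ i, b i ≤ 1) : packBits n b < 2 ^ n := by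
  induction n with
  | zero => simp [packBits]
  | succ n ih =>
    rw [packBits_succ, pow_succ]
    have := Nat.mul_le_mul_left (2 ^ n) (hb n)
    omega

theorem packBits_div_mod {n : ℕ} {b : ℕ → ℕ} (hb : ∀ i, b i ≤ 1) {i : ℕ} (hi : i < n) :
    packBits n b / 2 ^ i % 2 = b i := by
  induction n with
  | zero => omega
  | succ n ih =>
    rw [packBits_succ]
    rcases Nat.lt_succ_iff_lt_or_eq.1 hi with h | rfl
    · have : 2 ^ n * b n = 2 ^ i * (2 * (2 ^ (n - i - 1) * b n)) := by
        rw [← mul_assoc, ← mul_assoc, ← pow_succ, ← pow_add]; congr 2; omega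
      rw [this, Nat.add_mul_div_left _ _ (by positivity), Nat.add_mul_mod_self_left, ih h]
    · rw [Nat.add_mul_div_left _ _ (by positivity), Nat.div_eq_of_lt (packBits_lt _ hb), zero_add]
      have := hb i
      omega

section Keys

variable (n : ℕ) (a : ℕ → ℕ → ℕ) (w : ℕ → ℂ)

/-- The parities of the numbers of neighbours in `Z` of the vertices outside `X`, as a number. -/
def key (X Z : Finset ℕ) : ℕ :=
  packBits n fun u => if u ∈ X then 0 else (∑ v ∈ Z, a v u) % 2

/-- The keys of all subsets of `X`. -/
def keys (X : Finset ℕ) : Finset ℕ := X.powerset.image (key n a X)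

/-- The key after the vertex `v` has been added to `X`, and to the subset if `z = 1`. -/
def stepKey (X : Finset ℕ) (v z y : ℕ) : ℕ :=
  packBits n fun u => if u ∈ insert v X then 0 else (y / 2 ^ u + z * a v u) % 2

/-- The summand of the bit assignment with support `Z`. -/
def weight (Z : Finset ℕ) : ℂ := ∏ v ∈ Z, (w v * ∏ u ∈ Z with u < v, (-1) ^ a u v)

/-- The sum of the weights of the subsets of `X` with a given key. -/
def table (X : Finset ℕ) (y : ℕ) : ℂ := ∑ Z ∈ X.powerset with key n a X Z = y, weight a w Z

theorem key_lt (X Z : Finset ℕ) : key n a X Z < 2 ^ n :=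
  packBits_lt _ fun i => by split_ifs <;> omega

theorem stepKey_lt (X : Finset ℕ) (v z y : ℕ) : stepKey n a X v z y < 2 ^ n :=
  packBits_lt _ fun i => by split_ifs <;> omega

variable {n a w} {X Z : Finset ℕ} {v : ℕ}

theorem lt_of_mem_keys {y : ℕ} (h : y ∈ keys n a X) : y < 2 ^ n := by
  obtain ⟨Z, _, rfl⟩ := mem_image.1 h
  exact key_lt _ _ _ _

theorem key_div_mod {u : ℕ} (hu : u < n) (hX : u ∉ X) :
    key n a X Z / 2 ^ u % 2 = (∑ v ∈ Z, a v u) % 2 := by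
  rw [key, packBits_div_mod (fun i => by split_ifs <;> omega) hu, if_neg hX]

theorem stepKey_zero : stepKey n a X v 0 (key n a X Z) = key n a (insert v X) Z := by
  refine packBits_congr fun u hu => ?_
  by_cases h : u ∈ insert v X
  · simp [h]
  · have hX : u ∉ X := fun h' => h (mem_insert_of_mem h')
    simp only [h, if_false, zero_mul, add_zero, key_div_mod hu hX]

/-- Adding `v` to `Z` changes the parity at `u` by `a v u`, so the old key determines the new one;
the digit of `v` itself is dropped. -/
theorem stepKey_one (hv : v ∉ Z) :
    stepKey n a X v 1 (key n a X Z) = key n a (insert v X) (insert v Z) := by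
  refine packBits_congr fun u hu => ?_
  by_cases h : u ∈ insert v X
  · simp [h]
  · have hX : u ∉ X := fun h' => h (mem_insert_of_mem h')
    simp only [h, if_false, one_mul]
    rw [Nat.add_mod, key_div_mod hu hX, sum_insert hv]
    omega

/-- The sign of an edge is charged to its larger end. The edges from `v` to smaller members of `Z`
come from the factor of `v`, those to larger members from the factors of these; by symmetry of `a`
both have the form `(-1) ^ a u v`. -/
theorem weight_insert (ha : ∀ u v, a u v = a v u) (hv : v ∉ Z) :
    weight a w (insert v Z) = weight a w Z * (w v * (-1) ^ (∑ u ∈ Z, a u v)) := by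
  have h1 : ∀ x ∈ Z, (w x * ∏ u ∈ insert v Z with u < x, (-1 : ℂ) ^ a u x) =
      (w x * ∏ u ∈ Z with u < x, (-1 : ℂ) ^ a u x) * (if v < x then (-1) ^ a x v else 1) := by
    intro x hx
    by_cases h : v < x
    · rw [filter_insert, if_pos h, prod_insert (by simp [hv]), if_pos h, ha v x]; ring
    · rw [filter_insert, if_neg h, if_neg h, mul_one]
  rw [weight, prod_insert hv, prod_congr rfl h1, prod_mul_distrib, filter_insert,
    if_neg (lt_irrefl v), weight, ← prod_pow_eq_pow_sum,
    ← prod_filter_mul_prod_filter_not Z (fun u => u < v) (fun u => (-1 : ℂ) ^ a u v),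
    ← prod_filter]
  have : {x ∈ Z | v < x} = {x ∈ Z | ¬ x < v} := by
    refine filter_congr fun x hx => ?_
    have : x ≠ v := by rintro rfl; exact hv hx
    omega
  rw [this]
  ring

/-- The summand of the key `y` in the table after the vertex `v` has been added. -/
def contribution (n : ℕ) (a : ℕ → ℕ → ℕ) (w : ℕ → ℂ) (X : Finset ℕ) (v z y : ℕ) : ℂ :=
  if z = 0 then table n a w X y else table n a w X y * (w v * (-1) ^ (y / 2 ^ v % 2))

/-- The subsets of `insert v X` are split by whether they contain `v` and grouped by their key with
respect to `X`. Within a group the new factor is constant, because the parity of the number of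
neighbours of `v` is the digit `v` of the key, and the new key is constant as well. -/
theorem table_insert (ha : ∀ u v, a u v = a v u) (hn : v < n) (hv : v ∉ X) (y' : ℕ) :
    table n a w (insert v X) y' = ∑ y ∈ keys n a X,
      ((if stepKey n a X v 0 y = y' then contribution n a w X v 0 y else 0) +
        if stepKey n a X v 1 y = y' then contribution n a w X v 1 y else 0) := by
  have hvZ : ∀ Z ∈ X.powerset, v ∉ Z := fun Z hZ h => hv (mem_powerset.1 hZ h)
  rw [table, sum_filter, sum_powerset_insert hv, ← sum_add_distrib,
    ← sum_fiberwise_of_maps_to (g := key n a X) (t := keys n a X)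
      (fun Z hZ => mem_image_of_mem _ hZ)]
  refine sum_congr rfl fun y hy => ?_
  have h0 : contribution n a w X v 0 y = ∑ Z ∈ X.powerset with key n a X Z = y, weight a w Z := by
    simp [contribution, table]
  have h1 : contribution n a w X v 1 y = ∑ Z ∈ X.powerset with key n a X Z = y,
      weight a w (insert v Z) := by
    simp only [contribution, one_ne_zero, if_false, table, sum_mul]
    refine sum_congr rfl fun Z hZ => ?_
    rw [mem_filter] at hZ
    rw [weight_insert ha (hvZ Z hZ.1), ← hZ.2, key_div_mod hn hv, ← neg_one_pow_eq_pow_mod_two]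
  have hite : ∀ (p : Prop) [Decidable p] (f : Finset ℕ → ℂ) (S : Finset (Finset ℕ)),
      (if p then ∑ Z ∈ S, f Z else 0) = ∑ Z ∈ S, if p then f Z else 0 := by
    intro p _ f S
    split_ifs <;> simp
  rw [h0, h1, hite, hite, ← sum_add_distrib]
  refine sum_congr rfl fun Z hZ => ?_
  rw [mem_filter] at hZ
  rw [← hZ.2, stepKey_zero, stepKey_one (hvZ Z hZ.1)]

theorem keys_insert (hv : v ∉ X) : keys n a (insert v X) =
    (keys n a X).image (stepKey n a X v 0) ∪ (keys n a X).image (stepKey n a X v 1) := by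
  rw [keys, powerset_insert, image_union, image_image, keys, image_image, image_image]
  congr 1
  · exact image_congr fun Z _ => stepKey_zero.symm
  · exact image_congr fun Z hZ => (stepKey_one fun h => hv (mem_powerset.1 hZ h)).symm

/-- Each key has at most two successors, one for each bit of the new spider. -/
theorem card_keys_insert_le (v : ℕ) (X : Finset ℕ) :
    (keys n a (insert v X)).card ≤ 2 * (keys n a X).card := by
  by_cases hv : v ∈ X
  · rw [insert_eq_of_mem hv]; omega
  · rw [keys_insert hv]
    refine (card_union_le _ _).trans ?_
    have h1 := card_image_le (s := keys n a X) (f := stepKey n a X v 0)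
    have h2 := card_image_le (s := keys n a X) (f := stepKey n a X v 1)
    omega

theorem card_keys_union_le (X Y : Finset ℕ) :
    (keys n a (Y ∪ X)).card ≤ 2 ^ Y.card * (keys n a X).card := by
  induction Y using Finset.induction_on with
  | empty => simp
  | insert v Y hv ih =>
    rw [insert_union, card_insert_of_notMem hv, pow_succ]
    have := card_keys_insert_le (n := n) (a := a) v (Y ∪ X)
    linarith

@[simp]
theorem key_empty : key n a X ∅ = 0 := by simp [key, packBits]

@[simp]
theorem keys_empty : keys n a ∅ = {0} := by simp [keys]

theorem table_empty (y : ℕ) : table n a w ∅ y = if y = 0 then 1 else 0 := by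
  rw [table, powerset_empty, sum_filter, sum_singleton, key_empty]
  simp [weight, eq_comm]

/-- When no vertex is left outside, all keys are 0 and a single cell holds the whole sum. -/
theorem table_range : table n a w (range n) 0 = ∑ Z ∈ (range n).powerset, weight a w Z := by
  rw [table, filter_true_of_mem]
  intro Z _
  exact sum_eq_zero (s := range n) fun i hi => by simp only [if_pos hi, mul_zero]

end Keys

/-! ### The program -/

namespace Contract

open NExpr Program

/-- Adds the summand that belongs to the key in variable 9 and the bit in variable 10 of the spider
in variable 7 to the next level of the table. -/
def addSummand : Program :=
  .seq (.assign 12 (.const 0))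
  (.seq (forLoop 11 0 (.assign 12 (.add (.var 12) (.mul (.read 3 (.var 11))
      (.mul (.sub (.const 1) (.read 6 (.var 11)))
        (.mod (.add (.div (.var 9) (.read 3 (.var 11)))
          (.mul (.var 10) (.read 0 (.add (.mul (.var 7) (.var 0)) (.var 11))))) (.const 2)))))))
  (.seq (.assign 13 (.add (.mul (.var 12) (.add (.var 0) (.const 1)))
      (.add (.var 2) (.const 1))))
  (.seq (.branch (.read 8 (.var 13)) .skip
      (.seq (.nstore 8 (.var 13) (.const 1))
      (.seq (.nstore 7 (.add (.mul (.var 6) (.add (.var 0) (.const 1)))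
          (.add (.var 2) (.const 1))) (.var 12))
        (.assign 6 (.add (.var 6) (.const 1))))))
    (.branch (.var 10)
      (.branch (.mod (.div (.var 9) (.read 3 (.var 7))) (.const 2))
        (.cstore 1 (.var 13) (.sub (.read 1 (.var 13))
          (.mul (.read 1 (.add (.mul (.var 9) (.add (.var 0) (.const 1))) (.var 2)))
            (.phaseFactor (.var 7)))))
        (.cstore 1 (.var 13) (.add (.read 1 (.var 13))
          (.mul (.read 1 (.add (.mul (.var 9) (.add (.var 0) (.const 1))) (.var 2)))
            (.phaseFactor (.var 7))))))
      (.cstore 1 (.var 13) (.add (.read 1 (.var 13))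
          (.read 1 (.add (.mul (.var 9) (.add (.var 0) (.const 1))) (.var 2)))))))))

/-- Computes the next level of the table by summing out the spider in variable 7. -/
def addSpider : Program :=
  .seq (.nstore 6 (.var 7) (.const 1))
  (.seq (.assign 6 (.const 0))
  (.seq (forLoop 8 5
      (.seq (.assign 9 (.read 7 (.add (.mul (.var 8) (.add (.var 0) (.const 1))) (.var 2))))
      (.seq (.assign 10 (.const 0))
      (.seq addSummand
      (.seq (.assign 10 (.const 1))
        addSummand)))))
  (.seq (.assign 2 (.add (.var 2) (.const 1)))
    (.assign 5 (.var 6)))))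

end Contract

/-- The numerical data of a diagram and a decomposition: the numbers of spiders and of tree nodes,
the two adjacency matrices, the leaves and the phase factors. -/
structure Instance where
  n : ℕ
  m : ℕ
  a : ℕ → ℕ → ℕ
  b : ℕ → ℕ → ℕ
  l : ℕ → ℕ
  w : ℕ → ℂ

namespace Instance

/-- The memory holds the data `I`. -/
structure Holds (I : Instance) (s : Memory) : Prop where
  n : s.nvar 0 = I.n
  m : s.nvar 1 = I.m
  a : ∀ u < I.n, ∀ v < I.n, s.narr 0 (u * I.n + v) = I.a u v
  b : ∀ u < I.m, ∀ v < I.m, s.narr 1 (u * I.m + v) = I.b u v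
  l : ∀ x < I.n, s.narr 2 x = I.l x
  w : ∀ x < I.n, Complex.exp (Complex.I * s.phase x) = I.w x

/-- The memory holds the data `I`, the powers of two, and the list of the leaves. -/
structure Prepared (I : Instance) (s : Memory) : Prop extends I.Holds s where
  pow : ∀ u < I.n, s.narr 3 u = 2 ^ u
  leaf : ∀ v, s.narr 4 v = if v ∈ (range I.n).image I.l then 1 else 0

variable {I : Instance}

theorem Holds.of_frame {P : Program} {s s' : Memory} (h : I.Holds s) (hF : Frame P s s')
    (h0 : (P.writesVar 0 || P.writesVar 1 || P.writesArr 0 || P.writesArr 1 || P.writesArr 2)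
      = false := by decide) : I.Holds s' := by
  simp only [Bool.or_eq_false_iff] at h0
  obtain ⟨⟨⟨⟨h0, h1⟩, h2⟩, h3⟩, h4⟩ := h0
  refine ⟨?_, ?_, ?_, ?_, ?_, ?_⟩
  · rw [hF.nvar 0 h0, h.n]
  · rw [hF.nvar 1 h1, h.m]
  · rw [hF.narr 0 h2]; exact h.a
  · rw [hF.narr 1 h3]; exact h.b
  · rw [hF.narr 2 h4]; exact h.l
  · rw [hF.phase]; exact h.w

theorem Prepared.of_frame {P : Program} {s s' : Memory} (h : I.Prepared s) (hF : Frame P s s')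
    (h0 : (P.writesVar 0 || P.writesVar 1 || P.writesArr 0 || P.writesArr 1 || P.writesArr 2)
      = false := by decide)
    (h3 : P.writesArr 3 = false := by decide) (h4 : P.writesArr 4 = false := by decide) :
    I.Prepared s' := by
  refine ⟨h.toHolds.of_frame hF h0, ?_, ?_⟩
  · rw [hF.narr 3 h3]; exact h.pow
  · rw [hF.narr 4 h4]; exact h.leaf

end Instance

/-! ### Storing the tables in memory -/

theorem mul_succ_add_inj {n y y' t t' : ℕ} (ht : t ≤ n) (ht' : t' ≤ n) :
    y * (n + 1) + t = y' * (n + 1) + t' ↔ y = y' ∧ t = t' := by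
  constructor
  · intro h
    have h1 := congrArg (· / (n + 1)) h
    have h2 := congrArg (· % (n + 1)) h
    simp only [mul_comm _ (n + 1), Nat.mul_add_div (Nat.succ_pos n),
      Nat.div_eq_of_lt (Nat.lt_succ_of_le ht), Nat.div_eq_of_lt (Nat.lt_succ_of_le ht'),
      Nat.mul_add_mod, Nat.mod_eq_of_lt (Nat.lt_succ_of_le ht),
      Nat.mod_eq_of_lt (Nat.lt_succ_of_le ht'), add_zero] at h1 h2
    exact ⟨h1, h2⟩
  · rintro ⟨rfl, rfl⟩; rfl

/-- Level `t` of the arrays `L` (list of keys), `S` (membership flags) and `C` (values)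
holds the table `g` with the set of keys `K`, which has `len` elements. -/
structure IsTable (n : ℕ) (L S : ℕ → ℕ) (C : ℕ → ℂ) (t : ℕ) (K : Finset ℕ) (g : ℕ → ℂ)
    (len : ℕ) : Prop where
  image : (range len).image (fun j => L (j * (n + 1) + t)) = K
  inj : Set.InjOn (fun j => L (j * (n + 1) + t)) (range len)
  seen : ∀ y, S (y * (n + 1) + t) = if y ∈ K then 1 else 0
  val : ∀ y, C (y * (n + 1) + t) = g y

namespace IsTable

variable {n : ℕ} {L S : ℕ → ℕ} {C : ℕ → ℂ} {t : ℕ} {K : Finset ℕ} {g : ℕ → ℂ} {len : ℕ}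

theorem card (h : IsTable n L S C t K g len) : K.card = len := by
  rw [← h.image, card_image_of_injOn h.inj, card_range]

theorem insert_key (h : IsTable n L S C t K g len) (ht : t ≤ n) {y : ℕ} (hy : y ∉ K) :
    IsTable n (Function.update L (len * (n + 1) + t) y) (Function.update S (y * (n + 1) + t) 1)
      C t (insert y K) g (len + 1) := by
  have hL : ∀ j, Function.update L (len * (n + 1) + t) y (j * (n + 1) + t) =
      if j = len then y else L (j * (n + 1) + t) := by
    intro j
    simp only [Function.update_apply, mul_succ_add_inj ht ht, and_true]
  have himg : (range len).image (fun j => Function.update L (len * (n + 1) + t) y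
      (j * (n + 1) + t)) = K := by
    rw [← h.image]
    refine image_congr fun j hj => ?_
    have : j ≠ len := by have := mem_range.1 hj; omega
    simp only [hL, this, if_false]
  refine ⟨?_, ?_, ?_, h.val⟩
  · rw [range_add_one, image_insert, himg, hL, if_pos rfl]
  · rw [range_add_one, coe_insert, Set.injOn_insert (by simp)]
    refine ⟨?_, ?_⟩
    · intro i hi j hj hij
      have hi' : i ≠ len := by have := mem_range.1 hi; omega
      have hj' : j ≠ len := by have := mem_range.1 hj; omega
      simp only [hL, hi', hj', if_false] at hij
      exact h.inj hi hj hij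
    · rw [← coe_image, himg]
      simpa [hL] using hy
  · intro y'
    simp only [Function.update_apply, mul_succ_add_inj ht ht, and_true, mem_insert, h.seen]
    by_cases h' : y' = y <;> simp [h']

theorem add_val (h : IsTable n L S C t K g len) (ht : t ≤ n) (y : ℕ) (c : ℂ) :
    IsTable n L S (Function.update C (y * (n + 1) + t) (C (y * (n + 1) + t) + c)) t K
      (fun y' => g y' + if y = y' then c else 0) len := by
  refine ⟨h.image, h.inj, h.seen, fun y' => ?_⟩
  simp only [Function.update_apply, mul_succ_add_inj ht ht, and_true, h.val]
  by_cases h' : y' = y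
  · subst h'; simp
  · simp [h', Ne.symm h']

end IsTable

theorem packBits_lt_of_le {n : ℕ} {b : ℕ → ℕ} (hb : ∀ i, b i ≤ 1) {j : ℕ} (hj : j ≤ n) :
    packBits j b < 2 ^ n :=
  (packBits_lt j hb).trans_le (Nat.pow_le_pow_right (by norm_num) hj)

theorem two_pow_add_one_lt {n : ℕ} (hn : 1 ≤ n) : 2 ^ n + 1 < 2 ^ (2 * n + 1) := by
  have h1 : 2 ^ (n + 1) ≤ 2 ^ (2 * n + 1) := Nat.pow_le_pow_right (by norm_num) (by omega)
  have h2 : 2 ^ 1 ≤ 2 ^ n := Nat.pow_le_pow_right (by norm_num) hn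
  rw [pow_succ] at h1
  omega

/-- Since `n + 1 ≤ 2 ^ n`, the cell addresses stay below `2 ^ n * 2 ^ n`. This is why the word
length `2 * n + 1` suffices although keys alone take `n` bits. -/
theorem address_lt {n y t : ℕ} (hy : y < 2 ^ n) (ht : t ≤ n) :
    y * (n + 1) + t < 2 ^ (2 * n + 1) := by
  have h1 : n + 1 ≤ 2 ^ n := Nat.lt_two_pow_self
  have h2 : 2 ^ (2 * n + 1) = 2 * (2 ^ n * 2 ^ n) := by rw [pow_succ, two_mul, pow_add]; ring
  have h3 : (y + 1) * (n + 1) ≤ 2 ^ n * 2 ^ n := Nat.mul_le_mul hy h1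
  rw [h2]
  nlinarith

/-! ### Correctness and cost of summing out one spider -/

namespace Contract

variable {I : Instance}

/-- `K` and `g` describe the partly built level `t + 1`. The second half of the conclusion, that all
other levels are unchanged, lets the caller keep reading level `t` while the next one is written. -/
theorem ex_addSummand {s : Memory} (hs : I.Prepared s) {X : Finset ℕ} {x t y z len : ℕ}
    {K : Finset ℕ} {g : ℕ → ℂ} {c : ℂ}
    (hx : x < I.n) (ht : t + 1 ≤ I.n) (hK : K ⊆ range (2 ^ I.n))
    (hdone : ∀ u < I.n, s.narr 6 u = if u ∈ insert x X then 1 else 0)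
    (h2 : s.nvar 2 = t) (h6 : s.nvar 6 = len) (h7 : s.nvar 7 = x) (h9 : s.nvar 9 = y)
    (h10 : s.nvar 10 = z)
    (hT : IsTable I.n (s.narr 7) (s.narr 8) (s.carr 1) (t + 1) K g len)
    (hc : s.carr 1 (y * (I.n + 1) + t) = c) :
    Ex (2 * I.n + 1) addSummand s (3 * I.n + 11) (fun s' =>
      IsTable I.n (s'.narr 7) (s'.narr 8) (s'.carr 1) (t + 1)
        (insert (stepKey I.n I.a X x z y) K)
        (fun y' => g y' + if stepKey I.n I.a X x z y = y' then
          (if z = 0 then c else c * (I.w x * (-1) ^ (y / 2 ^ x % 2))) else 0) (s'.nvar 6) ∧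
      ∀ y, ∀ t' ≤ I.n, t' ≠ t + 1 →
        s'.narr 7 (y * (I.n + 1) + t') = s.narr 7 (y * (I.n + 1) + t') ∧
        s'.narr 8 (y * (I.n + 1) + t') = s.narr 8 (y * (I.n + 1) + t') ∧
        s'.carr 1 (y * (I.n + 1) + t') = s.carr 1 (y * (I.n + 1) + t')) := by
  have hM : 1 ≤ 2 * I.n + 1 := by omega
  set y' := stepKey I.n I.a X x z y with hy'
  have hb1 : ∀ u, (if u ∈ insert x X then 0 else (y / 2 ^ u + z * I.a x u) % 2) ≤ 1 := by
    intro u; split_ifs <;> omega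
  have hy'lt : y' < 2 ^ I.n := stepKey_lt _ _ _ _ _ _
  have hpow := two_pow_add_one_lt (n := I.n) (by omega)
  -- The list has no repetitions and its entries are below `2 ^ I.n`, so the counter and the
  -- addresses in the list stay within the word length.
  have hlen : len ≤ 2 ^ I.n := by
    rw [← hT.card]; simpa using card_le_card hK
  have hB : 3 * I.n + 11 = 1 + ((I.n * (1 + 2) + 2) + (1 + ((1 + (1 + 1) + 1) + (1 + 1 + 1)))) := by
    ring
  rw [hB, addSummand]
  refine (Ex.assign hM (by simp [NExpr.eval]) (by decide)).seq fun s₁ F₁ q₁ => ?_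
  simp only [NExpr.eval] at q₁
  have c₁ := hs.of_frame F₁
  refine Ex.seq (Q₁ := fun s' => s'.nvar 12 = y') ?_ fun s₂ F₂ q₂ => ?_
  -- The new key is built digit by digit; the factor `1 - s.narr 6 u` blanks the digits of the
  -- spiders already treated, including `x`.
  · refine (Ex.forLoop hM c₁.n (fun j s' => s'.nvar 12 = packBits j fun u =>
        if u ∈ insert x X then 0 else (y / 2 ^ u + z * I.a x u) % 2) (by decide) (by decide)
        (by decide) (fun s' F' => ?_) (fun j s' F' hj h11 hI => ?_)).mono le_rfl fun _ _ h => h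
    · rw [F'.nvar 12 rfl, q₁]; simp [packBits]
    · have c' := c₁.of_frame F'
      have e1 : s'.nvar 9 = y := by rw [F'.nvar 9 rfl, F₁.nvar 9 rfl, h9]
      have e2 : s'.nvar 10 = z := by rw [F'.nvar 10 rfl, F₁.nvar 10 rfl, h10]
      have e3 : s'.nvar 7 = x := by rw [F'.nvar 7 rfl, F₁.nvar 7 rfl, h7]
      have e4 : s'.narr 6 j = if j ∈ insert x X then 1 else 0 := by
        rw [F'.narr 6 rfl, F₁.narr 6 rfl, hdone j hj]
      have hval : packBits j (fun u =>
          if u ∈ insert x X then 0 else (y / 2 ^ u + z * I.a x u) % 2) + 2 ^ j *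
          ((1 - if j ∈ insert x X then 1 else 0) * ((y / 2 ^ j + z * I.a x j) % 2)) =
          packBits (j + 1) (fun u =>
          if u ∈ insert x X then 0 else (y / 2 ^ u + z * I.a x u) % 2) := by
        rw [packBits_succ]
        by_cases h : j ∈ insert x X <;> simp [h]
      refine (Ex.assign hM ?_ (by decide)).mono le_rfl fun s'' F'' q'' s₃ F₃ => ?_
      · simp only [NExpr.eval, hI, h11, c'.pow j hj, e1, e2, e3, e4, c'.n, c'.a x hx j hj]
        rw [hval]
        exact (packBits_lt_of_le hb1 hj).trans (by omega)
      · simp only [NExpr.eval, hI, h11, c'.pow j hj, e1, e2, e3, e4, c'.n, c'.a x hx j hj] at q''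
        rw [F₃.nvar 12 rfl, q'', hval]
  have c₂ := c₁.of_frame F₂
  have h2' : s₂.nvar 2 = t := by rw [F₂.nvar 2 rfl, F₁.nvar 2 rfl, h2]
  have ha : y' * (I.n + 1) + (t + 1) < 2 ^ (2 * I.n + 1) := address_lt hy'lt ht
  refine (Ex.assign hM (by simpa only [NExpr.eval, q₂, c₂.n, h2'] using ha)
    (by decide)).seq fun s₃ F₃ q₃ => ?_
  simp only [NExpr.eval, q₂, c₂.n, h2'] at q₃
  have c₃ := c₂.of_frame F₃
  have g2 : s₃.nvar 2 = t := by rw [F₃.nvar 2 rfl, h2']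
  have g6 : s₃.nvar 6 = len := by rw [F₃.nvar 6 rfl, F₂.nvar 6 rfl, F₁.nvar 6 rfl, h6]
  have g7 : s₃.nvar 7 = x := by rw [F₃.nvar 7 rfl, F₂.nvar 7 rfl, F₁.nvar 7 rfl, h7]
  have g9 : s₃.nvar 9 = y := by rw [F₃.nvar 9 rfl, F₂.nvar 9 rfl, F₁.nvar 9 rfl, h9]
  have g10 : s₃.nvar 10 = z := by rw [F₃.nvar 10 rfl, F₂.nvar 10 rfl, F₁.nvar 10 rfl, h10]
  have g12 : s₃.nvar 12 = y' := by rw [F₃.nvar 12 rfl, q₂]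
  have a7 : s₃.narr 7 = s.narr 7 := by rw [F₃.narr 7 rfl, F₂.narr 7 rfl, F₁.narr 7 rfl]
  have a8 : s₃.narr 8 = s.narr 8 := by rw [F₃.narr 8 rfl, F₂.narr 8 rfl, F₁.narr 8 rfl]
  have a1 : s₃.carr 1 = s.carr 1 := by rw [F₃.carr 1 rfl, F₂.carr 1 rfl, F₁.carr 1 rfl]
  refine Ex.seq (Q₁ := fun s' => IsTable I.n (s'.narr 7) (s'.narr 8) (s'.carr 1) (t + 1)
      (insert y' K) g (s'.nvar 6) ∧ ∀ y, ∀ t' ≤ I.n, t' ≠ t + 1 →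
        s'.narr 7 (y * (I.n + 1) + t') = s.narr 7 (y * (I.n + 1) + t') ∧
        s'.narr 8 (y * (I.n + 1) + t') = s.narr 8 (y * (I.n + 1) + t')) ?_
    fun s₄ F₄ ⟨q₄, r₄⟩ => ?_
  -- The membership flag decides whether the key has to be appended to the list; the value is added
  -- in either case.
  · have hread : s₃.narr 8 (s₃.nvar 13) = if y' ∈ K then 1 else 0 := by
      rw [q₃, a8, hT.seen]
    refine Ex.branch hM (by decide) (fun h => ?_) (fun h => ?_)
    · have hy'K : y' ∈ K := by
        by_contra hn
        simp [NExpr.eval, hread, hn] at h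
      refine Ex.mono (Ex.skip hM (Q := fun s' => s' = s₃) rfl) (by omega) ?_
      intro s' _ h'
      rw [h', insert_eq_of_mem hy'K, a7, a8, a1, g6]
      exact ⟨hT, fun _ _ _ _ => ⟨rfl, rfl⟩⟩
    · have hy'K : y' ∉ K := by
        intro hn
        simp [NExpr.eval, hread, hn] at h
      refine (Ex.nstore hM (by simp [NExpr.eval]) (by decide)).seq fun s₄ F₄ q₄ => ?_
      have n4 : s₄.nvar = s₃.nvar := funext fun i => F₄.nvar i rfl
      have hlt : (NExpr.var 12).eval s₄ < 2 ^ (2 * I.n + 1) := by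
        simp only [NExpr.eval, n4, g12]; omega
      refine Ex.seq (B₁ := 1) (B₂ := 1) (Ex.nstore hM hlt (by decide)) fun s₅ F₅ q₅ => ?_
      have n5 : s₅.nvar = s₃.nvar := (funext fun i => F₅.nvar i rfl).trans n4
      refine (Ex.assign hM (by simp only [NExpr.eval, n5, g6]; omega) (by decide)).mono le_rfl
        fun s₆ F₆ q₆ => ?_
      simp only [NExpr.eval, n5, n4, g6, g12, g2, c₃.n, q₃] at q₄ q₅ q₆
      rw [F₄.narr 7 rfl, a7] at q₅
      rw [q₆, F₆.narr 7 rfl, F₆.narr 8 rfl, F₆.carr 1 rfl, F₅.narr 8 rfl, F₅.carr 1 rfl,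
        F₄.carr 1 rfl, q₄, q₅, a8, a1]
      refine ⟨hT.insert_key ht hy'K, fun y t' ht' hne => ?_⟩
      simp [mul_succ_add_inj ht' ht, hne]
  have n13 : s₄.nvar 13 = y' * (I.n + 1) + (t + 1) := by rw [F₄.nvar 13 rfl, q₃]
  have n2 : s₄.nvar 2 = t := by rw [F₄.nvar 2 rfl, g2]
  have n7 : s₄.nvar 7 = x := by rw [F₄.nvar 7 rfl, g7]
  have n9 : s₄.nvar 9 = y := by rw [F₄.nvar 9 rfl, g9]
  have n10 : s₄.nvar 10 = z := by rw [F₄.nvar 10 rfl, g10]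
  have c₄ := c₃.of_frame F₄
  have a1' : s₄.carr 1 = s.carr 1 := by rw [F₄.carr 1 rfl, a1]
  -- The three final branches differ only in the summand `d`.
  have fin : ∀ s₅ : Memory, ∀ d : ℂ, s₅.narr 7 = s₄.narr 7 → s₅.narr 8 = s₄.narr 8 →
      s₅.nvar 6 = s₄.nvar 6 →
      s₅.carr 1 = Function.update (s₄.carr 1) (y' * (I.n + 1) + (t + 1))
        (s₄.carr 1 (y' * (I.n + 1) + (t + 1)) + d) →
      (if z = 0 then c else c * (I.w x * (-1) ^ (y / 2 ^ x % 2))) = d →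
      IsTable I.n (s₅.narr 7) (s₅.narr 8) (s₅.carr 1) (t + 1)
        (insert y' K) (fun y'' => g y'' + if y' = y'' then
          (if z = 0 then c else c * (I.w x * (-1) ^ (y / 2 ^ x % 2))) else 0) (s₅.nvar 6) ∧
      ∀ y, ∀ t' ≤ I.n, t' ≠ t + 1 →
        s₅.narr 7 (y * (I.n + 1) + t') = s.narr 7 (y * (I.n + 1) + t') ∧
        s₅.narr 8 (y * (I.n + 1) + t') = s.narr 8 (y * (I.n + 1) + t') ∧
        s₅.carr 1 (y * (I.n + 1) + t') = s.carr 1 (y * (I.n + 1) + t') := by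
    rintro s₅ d e7 e8 e6 e1 rfl
    rw [e7, e8, e6, e1]
    refine ⟨q₄.add_val ht y' _, fun y'' t' ht' hne => ⟨(r₄ y'' t' ht' hne).1,
      (r₄ y'' t' ht' hne).2, ?_⟩⟩
    rw [a1']
    simp [mul_succ_add_inj ht' ht, hne]
  refine Ex.branch hM (by decide) (fun h => ?_) (fun h => ?_)
  · have hz0 : z ≠ 0 := by simpa [NExpr.eval, n10] using h
    -- The sign is realised by choosing between subtraction and addition according to digit `x` of
    -- the key.
    refine Ex.branch hM (by decide) (fun h' => ?_) (fun h' => ?_)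
    · simp only [NExpr.eval, n9, n7, c₄.pow x hx] at h'
      refine (Ex.cstore hM (by decide)).mono le_rfl fun s₅ F₅ q₅ => ?_
      simp only [NExpr.eval, CExpr.eval, n13, n9, n7, n2, c₄.n, c₄.w x hx] at q₅
      refine fin s₅ _ (F₅.narr 7 rfl) (F₅.narr 8 rfl) (F₅.nvar 6 rfl)
        (q₅.trans (by rw [sub_eq_add_neg])) ?_
      have : y / 2 ^ x % 2 = 1 := by omega
      rw [if_neg hz0, this, a1', hc]; ring
    · simp only [NExpr.eval, n9, n7, c₄.pow x hx] at h'
      refine (Ex.cstore hM (by decide)).mono le_rfl fun s₅ F₅ q₅ => ?_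
      simp only [NExpr.eval, CExpr.eval, n13, n9, n7, n2, c₄.n, c₄.w x hx] at q₅
      refine fin s₅ _ (F₅.narr 7 rfl) (F₅.narr 8 rfl) (F₅.nvar 6 rfl) q₅ ?_
      rw [if_neg hz0, h', a1', hc]; ring
  · have hz0 : z = 0 := by simpa [NExpr.eval, n10] using h
    refine (Ex.cstore hM (by decide)).mono (by omega) fun s₅ F₅ q₅ => ?_
    simp only [NExpr.eval, CExpr.eval, n13, n9, n2, c₄.n] at q₅
    refine fin s₅ _ (F₅.narr 7 rfl) (F₅.narr 8 rfl) (F₅.nvar 6 rfl) q₅ ?_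
    rw [if_pos hz0, a1', hc]

end Contract

theorem IsTable.congr {n : ℕ} {L S L' S' : ℕ → ℕ} {C C' : ℕ → ℂ} {t : ℕ} {K : Finset ℕ} {g : ℕ → ℂ}
    {len : ℕ} (h : IsTable n L S C t K g len)
    (h' : ∀ y, L' (y * (n + 1) + t) = L (y * (n + 1) + t) ∧
      S' (y * (n + 1) + t) = S (y * (n + 1) + t) ∧ C' (y * (n + 1) + t) = C (y * (n + 1) + t)) :
    IsTable n L' S' C' t K g len := by
  have e : (fun j => L' (j * (n + 1) + t)) = fun j => L (j * (n + 1) + t) :=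
    funext fun j => (h' j).1
  exact ⟨by rw [e]; exact h.image, by rw [e]; exact h.inj, fun y => (h' y).2.1.trans (h.seen y),
    fun y => (h' y).2.2.trans (h.val y)⟩

/-- The memory holds the table of the set `X` of spiders, scaled by `c`. -/
structure Instance.Level (I : Instance) (c : ℂ) (X : Finset ℕ) (s : Memory) : Prop where
  done : ∀ u < I.n, s.narr 6 u = if u ∈ X then 1 else 0
  count : s.nvar 2 = X.card
  table : IsTable I.n (s.narr 7) (s.narr 8) (s.carr 1) X.card (keys I.n I.a X)
    (fun y => c * table I.n I.a I.w X y) (s.nvar 5)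
  empty : ∀ t, X.card < t → t ≤ I.n →
    IsTable I.n (s.narr 7) (s.narr 8) (s.carr 1) t ∅ (fun _ => 0) 0

theorem Instance.Level.of_frame {I : Instance} {c : ℂ} {X : Finset ℕ} {s s' : Memory}
    (h : I.Level c X s) {P : Program} (F : Frame P s s')
    (h0 : (P.writesVar 2 || P.writesVar 5 || P.writesArr 6 || P.writesArr 7 || P.writesArr 8 ||
      P.writesCArr 1) = false := by decide) : I.Level c X s' := by
  simp only [Bool.or_eq_false_iff] at h0
  obtain ⟨⟨⟨⟨⟨h0, h1⟩, h2⟩, h3⟩, h4⟩, h5⟩ := h0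
  obtain ⟨k0, k1, k2, k3⟩ := h
  rw [← F.nvar 2 h0] at k1
  rw [← F.narr 6 h2] at k0
  rw [← F.narr 7 h3, ← F.narr 8 h4, ← F.carr 1 h5] at k2 k3
  rw [← F.nvar 5 h1] at k2
  exact ⟨k0, k1, k2, k3⟩

namespace Contract

variable {I : Instance}

/-- One pass over the list of keys carries out the recursion of `table_insert`. The bound `B` on the
number of keys enters only the running time. -/
theorem ex_addSpider (ha : ∀ u v, I.a u v = I.a v u) {s : Memory} (hs : I.Prepared s)
    {X : Finset ℕ} {c : ℂ} (hl : I.Level c X s) {x : ℕ} (h7 : s.nvar 7 = x) (hx : x < I.n)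
    (hX : X ⊆ range I.n) (hxX : x ∉ X) {B : ℕ} (hB : (keys I.n I.a X).card ≤ B) :
    Ex (2 * I.n + 1) addSpider s (B * (6 * I.n + 27) + 6) (I.Level c (insert x X)) := by
  have hM : 1 ≤ 2 * I.n + 1 := by omega
  obtain ⟨len, hlen⟩ : ∃ len, s.nvar 5 = len := ⟨_, rfl⟩
  obtain ⟨t, ht⟩ : ∃ t, X.card = t := ⟨_, rfl⟩
  have htn : t + 1 ≤ I.n := by
    have : insert x X ⊆ range I.n := insert_subset (mem_range.2 hx) hX
    simpa [card_insert_of_notMem hxX, ht] using card_le_card this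
  have hpow := two_pow_add_one_lt (n := I.n) (by omega)
  have hnpow : I.n < 2 ^ I.n := Nat.lt_two_pow_self
  have hT := hl.table
  have h2 := hl.count
  rw [ht, hlen] at hT
  rw [ht] at h2
  have hlenB : len ≤ B := hT.card ▸ hB
  set ys : ℕ → ℕ := fun j => s.narr 7 (j * (I.n + 1) + t) with hys
  have hysK : ∀ j < len, ys j ∈ keys I.n I.a X := fun j hj => by
    rw [← hT.image]; exact mem_image_of_mem _ (mem_range.2 hj)
  set st := stepKey I.n I.a X x with hst
  set co := contribution I.n I.a I.w X x with hco
  -- Key set and values of the next level after the first `j` entries of the list have been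
  -- processed.
  set K : ℕ → Finset ℕ := fun j => (range j).biUnion fun i => {st 0 (ys i), st 1 (ys i)} with hKdef
  set g : ℕ → ℕ → ℂ := fun j y' => ∑ i ∈ range j, ((if st 0 (ys i) = y' then c * co 0 (ys i) else 0)
    + if st 1 (ys i) = y' then c * co 1 (ys i) else 0) with hg
  have hKlt : ∀ j, K j ⊆ range (2 ^ I.n) := by
    intro j y hy
    simp only [hKdef, mem_biUnion, mem_insert, mem_singleton] at hy
    obtain ⟨i, _, rfl | rfl⟩ := hy <;> exact mem_range.2 (stepKey_lt _ _ _ _ _ _)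
  have hKs : ∀ j, K (j + 1) = insert (stepKey I.n I.a X x 1 (ys j))
      (insert (stepKey I.n I.a X x 0 (ys j)) (K j)) := by
    intro j
    simp only [hKdef, range_add_one, biUnion_insert, hst, insert_union, singleton_union]
    exact insert_comm _ _ _
  have hgs : ∀ j, g (j + 1) = fun y' => (g j y' + if stepKey I.n I.a X x 0 (ys j) = y' then
      (if 0 = 0 then c * table I.n I.a I.w X (ys j)
        else c * table I.n I.a I.w X (ys j) * (I.w x * (-1) ^ (ys j / 2 ^ x % 2))) else 0) +
      if stepKey I.n I.a X x 1 (ys j) = y' then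
      (if 1 = 0 then c * table I.n I.a I.w X (ys j)
        else c * table I.n I.a I.w X (ys j) * (I.w x * (-1) ^ (ys j / 2 ^ x % 2))) else 0 := by
    intro j
    funext y'
    simp only [hg, sum_range_succ, hst, hco, contribution, if_true, one_ne_zero, if_false,
      mul_assoc, add_assoc]
  have hBound : B * (6 * I.n + 27) + 6 = 1 + (1 + ((B * (6 * I.n + 27) + 2) + (1 + 1))) := by ring
  rw [hBound, addSpider]
  refine (Ex.nstore hM (by simp [NExpr.eval]) (by decide)).seq fun s₁ F₁ q₁ => ?_
  simp only [NExpr.eval, h7] at q₁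
  refine (Ex.assign hM (by simp [NExpr.eval]) (by decide)).seq fun s₂ F₂ q₂ => ?_
  simp only [NExpr.eval] at q₂
  have c₂ : I.Prepared s₂ := (hs.of_frame F₁).of_frame F₂
  have e5 : s₂.nvar 5 = len := by rw [F₂.nvar 5 rfl, F₁.nvar 5 rfl, hlen]
  have e2 : s₂.nvar 2 = t := by rw [F₂.nvar 2 rfl, F₁.nvar 2 rfl, h2]
  have e7 : s₂.nvar 7 = x := by rw [F₂.nvar 7 rfl, F₁.nvar 7 rfl, h7]
  have b6 : ∀ u < I.n, s₂.narr 6 u = if u ∈ insert x X then 1 else 0 := by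
    intro u hu
    rw [F₂.narr 6 rfl, q₁, Function.update_apply, hl.done u hu]
    by_cases h : u = x <;> simp [h]
  have b7 : s₂.narr 7 = s.narr 7 := by rw [F₂.narr 7 rfl, F₁.narr 7 rfl]
  have b8 : s₂.narr 8 = s.narr 8 := by rw [F₂.narr 8 rfl, F₁.narr 8 rfl]
  have b1 : s₂.carr 1 = s.carr 1 := by rw [F₂.carr 1 rfl, F₁.carr 1 rfl]
  refine Ex.seq (Q₁ := fun s' => IsTable I.n (s'.narr 7) (s'.narr 8) (s'.carr 1) (t + 1) (K len)
      (g len) (s'.nvar 6) ∧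
      ∀ y, ∀ t' ≤ I.n, t' ≠ t + 1 →
        s'.narr 7 (y * (I.n + 1) + t') = s.narr 7 (y * (I.n + 1) + t') ∧
        s'.narr 8 (y * (I.n + 1) + t') = s.narr 8 (y * (I.n + 1) + t') ∧
        s'.carr 1 (y * (I.n + 1) + t') = s.carr 1 (y * (I.n + 1) + t')) ?_
    fun s₃ F₃ ⟨q₃, r₃⟩ => ?_
  · refine (Ex.forLoop (B := 6 * I.n + 25) hM e5 (fun j s' =>
      IsTable I.n (s'.narr 7) (s'.narr 8) (s'.carr 1) (t + 1) (K j) (g j) (s'.nvar 6) ∧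
      ∀ y, ∀ t' ≤ I.n, t' ≠ t + 1 →
        s'.narr 7 (y * (I.n + 1) + t') = s.narr 7 (y * (I.n + 1) + t') ∧
        s'.narr 8 (y * (I.n + 1) + t') = s.narr 8 (y * (I.n + 1) + t') ∧
        s'.carr 1 (y * (I.n + 1) + t') = s.carr 1 (y * (I.n + 1) + t')) (by decide)
        rfl rfl (fun s' F' => ?_) (fun j s' F' hj h8 hI => ?_)).mono ?_
        fun _ _ h => h
    · rw [F'.narr 7 rfl, F'.narr 8 rfl, F'.carr 1 rfl, F'.nvar 6 rfl, q₂, b7, b8, b1]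
      refine ⟨?_, fun _ _ _ _ => ⟨rfl, rfl, rfl⟩⟩
      have := hl.empty (t + 1) (by omega) htn
      simpa [K, g] using this
    · obtain ⟨hI, hr⟩ := hI
      have c' := c₂.of_frame F'
      have f2 : s'.nvar 2 = t := by rw [F'.nvar 2 rfl, e2]
      have f7 : s'.nvar 7 = x := by rw [F'.nvar 7 rfl, e7]
      have d6 : s'.narr 6 = s₂.narr 6 := F'.narr 6 rfl
      -- Level `t` is still intact, since only level `t + 1` has been written.
      have hread : s'.narr 7 (j * (I.n + 1) + t) = ys j := (hr j t (by omega) (by omega)).1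
      have hyj : ys j < 2 ^ I.n := lt_of_mem_keys (hysK j hj)
      have hB' : 6 * I.n + 25 = 1 + (1 + ((3 * I.n + 11) + (1 + (3 * I.n + 11)))) := by ring
      rw [hB']
      refine (Ex.assign hM (by simp only [NExpr.eval, h8, c'.n, f2, hread]; omega)
        (by decide)).seq fun s₃ F₃ q₃ => ?_
      simp only [NExpr.eval, h8, c'.n, f2, hread] at q₃
      have c₃ := c'.of_frame F₃
      refine (Ex.assign hM (by simp [NExpr.eval]) (by decide)).seq fun s₄ F₄ q₄ => ?_
      simp only [NExpr.eval] at q₄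
      have c₄ := c₃.of_frame F₄
      have a7 : s₄.narr 7 = s'.narr 7 := by rw [F₄.narr 7 rfl, F₃.narr 7 rfl]
      have a8 : s₄.narr 8 = s'.narr 8 := by rw [F₄.narr 8 rfl, F₃.narr 8 rfl]
      have a1 : s₄.carr 1 = s'.carr 1 := by rw [F₄.carr 1 rfl, F₃.carr 1 rfl]
      have hT₄ : IsTable I.n (s₄.narr 7) (s₄.narr 8) (s₄.carr 1) (t + 1) (K j) (g j)
          (s₄.nvar 6) := by
        rw [a7, a8, a1, F₄.nvar 6 rfl, F₃.nvar 6 rfl]; exact hI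
      have hval : s.carr 1 (ys j * (I.n + 1) + t) = c * table I.n I.a I.w X (ys j) := hT.val _
      refine (ex_addSummand c₄ (X := X) (x := x) (t := t) (y := ys j) (z := 0)
        (c := c * table I.n I.a I.w X (ys j)) hx htn (hKlt j)
        (by rw [F₄.narr 6 rfl, F₃.narr 6 rfl, d6]; exact b6)
        (by rw [F₄.nvar 2 rfl, F₃.nvar 2 rfl, f2]) rfl
        (by rw [F₄.nvar 7 rfl, F₃.nvar 7 rfl, f7]) (by rw [F₄.nvar 9 rfl, q₃]) q₄ hT₄
        (by rw [a1, (hr _ t (by omega) (by omega)).2.2, hval])).seq fun s₅ F₅ ⟨q₅, r₅⟩ => ?_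
      have c₅ := c₄.of_frame F₅
      refine (Ex.assign hM (by simp only [NExpr.eval]; omega) (by decide)).seq fun s₆ F₆ q₆ => ?_
      simp only [NExpr.eval] at q₆
      have c₆ := c₅.of_frame F₆
      have hT₆ := q₅
      rw [← F₆.narr 7 rfl, ← F₆.narr 8 rfl, ← F₆.carr 1 rfl, ← F₆.nvar 6 rfl] at hT₆
      refine (ex_addSummand c₆ (X := X) (x := x) (t := t) (y := ys j) (z := 1)
        (c := c * table I.n I.a I.w X (ys j)) hx htn
        (insert_subset (mem_range.2 (stepKey_lt _ _ _ _ _ _)) (hKlt j))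
        (by rw [F₆.narr 6 rfl, F₅.narr 6 rfl, F₄.narr 6 rfl, F₃.narr 6 rfl, d6]; exact b6)
        (by rw [F₆.nvar 2 rfl, F₅.nvar 2 rfl, F₄.nvar 2 rfl, F₃.nvar 2 rfl, f2]) rfl
        (by rw [F₆.nvar 7 rfl, F₅.nvar 7 rfl, F₄.nvar 7 rfl, F₃.nvar 7 rfl, f7])
        (by rw [F₆.nvar 9 rfl, F₅.nvar 9 rfl, F₄.nvar 9 rfl, q₃]) q₆ hT₆
        (by rw [F₆.carr 1 rfl, (r₅ _ t (by omega) (by omega)).2.2, a1,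
          (hr _ t (by omega) (by omega)).2.2, hval])).mono le_rfl
        fun s₇ F₇ ⟨q₇, r₇⟩ s₈ F₈ => ?_
      rw [F₈.narr 7 rfl, F₈.narr 8 rfl, F₈.carr 1 rfl, F₈.nvar 6 rfl]
      constructor
      · rw [hKs, hgs]; exact q₇
      · intro y t' ht' hne
        rw [(r₇ y t' ht' hne).1, (r₇ y t' ht' hne).2.1, (r₇ y t' ht' hne).2.2, F₆.narr 7 rfl,
          F₆.narr 8 rfl, F₆.carr 1 rfl, (r₅ y t' ht' hne).1, (r₅ y t' ht' hne).2.1,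
          (r₅ y t' ht' hne).2.2, a7, a8, a1]
        exact hr y t' ht' hne
    · have := Nat.mul_le_mul_right (6 * I.n + 27) hlenB
      have h3 : 6 * I.n + 25 + 2 = 6 * I.n + 27 := rfl
      rw [h3]
      omega
  · have f2 : s₃.nvar 2 = t := by rw [F₃.nvar 2 rfl, e2]
    refine (Ex.assign hM (by simp only [NExpr.eval, f2]; omega) (by decide)).seq fun s₄ F₄ q₄ => ?_
    simp only [NExpr.eval, f2] at q₄
    have hlen' : s₃.nvar 6 ≤ 2 ^ I.n := by
      rw [← q₃.card]; simpa using card_le_card (hKlt len)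
    refine (Ex.assign hM (by simp only [NExpr.eval, F₄.nvar 6 rfl]; omega) (by decide)).mono le_rfl
      fun s₅ F₅ q₅ => ?_
    simp only [NExpr.eval, F₄.nvar 6 rfl] at q₅
    have hcard : (insert x X).card = t + 1 := by rw [card_insert_of_notMem hxX, ht]
    have hKl : K len = keys I.n I.a (insert x X) := by
      rw [keys_insert hxX, ← hT.image, image_image, image_image]
      ext y
      simp only [hKdef, mem_biUnion, mem_union, mem_image, mem_insert, mem_singleton,
        Function.comp, mem_range]
      constructor
      · rintro ⟨i, hi, rfl | rfl⟩
        exacts [Or.inl ⟨i, hi, rfl⟩, Or.inr ⟨i, hi, rfl⟩]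
      · rintro (⟨i, hi, rfl⟩ | ⟨i, hi, rfl⟩)
        exacts [⟨i, hi, Or.inl rfl⟩, ⟨i, hi, Or.inr rfl⟩]
    have hgl : g len = fun y => c * table I.n I.a I.w (insert x X) y := by
      funext y
      rw [table_insert ha hx hxX, ← hT.image, sum_image hT.inj, mul_sum]
      simp only [hg, hst, hco, mul_add, mul_ite, mul_zero, hys]
    refine ⟨?_, ?_, ?_, ?_⟩
    · rw [F₅.narr 6 rfl, F₄.narr 6 rfl, F₃.narr 6 rfl]; exact b6
    · rw [F₅.nvar 2 rfl, q₄, hcard]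
    · rw [F₅.narr 7 rfl, F₅.narr 8 rfl, F₅.carr 1 rfl, F₄.narr 7 rfl, F₄.narr 8 rfl, F₄.carr 1 rfl,
        q₅, hcard, ← hKl, ← hgl]
      exact q₃
    · intro t' h1 h2
      rw [F₅.narr 7 rfl, F₅.narr 8 rfl, F₅.carr 1 rfl, F₄.narr 7 rfl, F₄.narr 8 rfl, F₄.carr 1 rfl]
      rw [hcard] at h1
      exact (hl.empty t' (by omega) h2).congr fun y => r₃ y t' h2 (by omega)

end Contract

namespace Contract

open NExpr Program

/-- Stores the powers of two and the list of the leaves, and computes the table of the empty set of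
spiders, which contains the product of the normalising factors of the edges. -/
def prepare : Program :=
  .seq (.nstore 3 (.const 0) (.const 1))
  (.seq (forLoop 11 0 (.nstore 3 (.add (.var 11) (.const 1)) (.mul (.read 3 (.var 11)) (.const 2))))
  (.seq (forLoop 7 0 (.nstore 4 (.read 2 (.var 7)) (.const 1)))
  (.seq (.cstore 1 (.const 0) .one)
  (.seq (forLoop 11 0 (forLoop 14 0
      (.branch (.mul (.sub (.var 14) (.var 11)) (.read 0 (.add (.mul (.var 11) (.var 0)) (.var 14))))
        (.cstore 1 (.const 0) (.mul (.read 1 (.const 0)) .invSqrtTwo)) .skip)))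
  (.seq (.nstore 8 (.const 0) (.const 1))
    (.assign 5 (.const 1)))))))

/-- Finds a node that is not a leaf and has at most one neighbour that is not a leaf. -/
def findStart : Program :=
  forLoop 15 1
    (.seq (.assign 16 (.const 0))
    (.seq (forLoop 14 1 (.assign 16 (.add (.var 16)
        (.mul (.read 1 (.add (.mul (.var 15) (.var 1)) (.var 14)))
          (.sub (.const 1) (.read 4 (.var 14)))))))
      (.branch (.mul (.sub (.const 1) (.read 4 (.var 15))) (.sub (.const 2) (.var 16)))
        (.assign 3 (.var 15)) .skip)))

/-- Sums out the spiders whose leaves are at the current node of the tree, and moves on to the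
next node that is not a leaf. -/
def visitNode : Program :=
  .seq (forLoop 7 0
      (.branch (.mul (.sub (.const 1) (.read 6 (.var 7)))
          (.add (.read 1 (.add (.mul (.read 2 (.var 7)) (.var 1)) (.var 3)))
            (.sub (.const 1) (.add (.sub (.read 2 (.var 7)) (.var 3))
              (.sub (.var 3) (.read 2 (.var 7)))))))
        addSpider .skip))
  (.seq (.nstore 5 (.var 3) (.const 1))
  (.seq (.assign 4 (.var 3))
  (.seq (forLoop 14 1
      (.branch (.mul (.read 1 (.add (.mul (.var 3) (.var 1)) (.var 14)))
          (.mul (.sub (.const 1) (.read 4 (.var 14))) (.sub (.const 1) (.read 5 (.var 14)))))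
        (.assign 4 (.var 14)) .skip))
    (.assign 3 (.var 4)))))

/-- The contraction algorithm. -/
def program : Program :=
  .seq prepare
  (.seq findStart
  (.seq (.loop (.sub (.var 0) (.var 2)) visitNode)
    (.cstore 0 (.const 0) (.read 1 (.var 0)))))

end Contract

/-! ### Data extracted from the path of inner nodes -/

namespace Instance

/-- The product of the normalising factors of the edges. -/
noncomputable def norm (I : Instance) : ℂ :=
  ∏ u ∈ range I.n, ∏ v ∈ range I.n,
    if (v - u) * I.a u v ≠ 0 then ((Real.sqrt 2 : ℝ) : ℂ)⁻¹ else 1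

/-- The tree node `v` is not a leaf and has at most one neighbour that is not a leaf. -/
def IsEnd (I : Instance) (v : ℕ) : Prop :=
  v ∉ (range I.n).image I.l ∧
    ∑ w ∈ range I.m, I.b v w * (1 - if w ∈ (range I.n).image I.l then 1 else 0) ≤ 1

/-- A path `p 0, …, p (N - 1)` in the tree such that every leaf is at exactly one node of
the path, and such that the sets of spiders below a given level have at most `2 ^ R` keys. -/
structure Layout (I : Instance) (R N : ℕ) (p lvl : ℕ → ℕ) : Prop where
  length_le : N ≤ I.n
  node_lt : ∀ i < N, p i < I.m
  lvl_lt : ∀ x < I.n, lvl x < N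
  attached : ∀ i < N, ∀ x < I.n, (I.b (I.l x) (p i) ≠ 0 ∨ I.l x = p i) ↔ lvl x = i
  next : ∀ i, i + 1 < N → ∀ w < I.m, (I.b (p i) w ≠ 0 ∧ w ∉ (range I.n).image I.l ∧
    ∀ j < i + 1, w ≠ p j) ↔ w = p (i + 1)
  card_lvl_le : ∀ i, #{x ∈ range I.n | lvl x = i} ≤ 3
  card_keys_le : ∀ i < N, #(keys I.n I.a {x ∈ range I.n | lvl x < i}) ≤ 2 ^ R

end Instance

/-! ### Correctness and cost of the whole program -/

namespace Contract

variable {I : Instance}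

/-- The product of the factors 1/√2 is stored as the only entry of the table of the empty set. By
linearity every later table carries this factor, and no correction is needed at the end. -/
theorem ex_prepare (hI : 1 ≤ I.n) {s : Memory} (hs : I.Holds s) (h2 : s.nvar 2 = 0)
    (hn : ∀ a, 3 ≤ a → s.narr a = fun _ => 0) (hc : s.carr 1 = fun _ => 0) :
    Ex (2 * I.n + 1) prepare s (4 * I.n ^ 2 + 10 * I.n + 10) (fun s' =>
      I.Prepared s' ∧ I.Level I.norm ∅ s') := by
  have hM : 1 ≤ 2 * I.n + 1 := by omega
  have hpow := two_pow_add_one_lt (n := I.n) hI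
  have hB : 4 * I.n ^ 2 + 10 * I.n + 10 = 1 + ((I.n * (1 + 2) + 2) + ((I.n * (1 + 2) + 2) +
    (1 + ((I.n * (I.n * (1 + 1 + 2) + 2 + 2) + 2) + (1 + 1))))) := by ring
  rw [hB, prepare]
  refine (Ex.nstore hM (by simp [NExpr.eval]) (by decide)).seq fun s₁ F₁ q₁ => ?_
  simp only [NExpr.eval] at q₁
  have c₁ := hs.of_frame F₁
  refine Ex.seq (Q₁ := fun s' => ∀ u ≤ I.n, s'.narr 3 u = 2 ^ u) ?_ fun s₂ F₂ q₂ => ?_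
  · refine Ex.forLoop hM c₁.n (fun j s' => ∀ u ≤ j, s'.narr 3 u = 2 ^ u) (by decide)
      rfl rfl (fun s' F' u hu => ?_) (fun j s' F' hj h11 hI => ?_)
    · obtain rfl : u = 0 := by omega
      rw [F'.narr 3 rfl, q₁]; simp
    · have hp : 2 ^ j * 2 ≤ 2 ^ I.n := by
        rw [← pow_succ]; exact Nat.pow_le_pow_right (by norm_num) hj
      refine (Ex.nstore hM (by simp only [NExpr.eval, h11, hI j le_rfl]; omega) (by decide)).mono
        le_rfl fun s₂ F₂ q₂ s₃ F₃ u hu => ?_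
      simp only [NExpr.eval, h11, hI j le_rfl] at q₂
      rw [F₃.narr 3 rfl, q₂, Function.update_apply]
      split_ifs with h
      · rw [h, pow_succ]
      · exact hI u (by omega)
  have c₂ := c₁.of_frame F₂
  refine Ex.seq (Q₁ := fun s' => ∀ v, s'.narr 4 v = if v ∈ (range I.n).image I.l then 1 else 0) ?_
    fun s₃ F₃ q₃ => ?_
  · refine Ex.forLoop hM c₂.n (fun j s' => ∀ v, s'.narr 4 v =
      if v ∈ (range j).image I.l then 1 else 0) (by decide)
      rfl rfl (fun s' F' v => ?_) (fun j s' F' hj h7 hI => ?_)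
    · rw [F'.narr 4 rfl, F₂.narr 4 rfl, F₁.narr 4 rfl, hn 4 (by omega)]; simp
    · refine (Ex.nstore hM (by simp [NExpr.eval]) (by decide)).mono
        le_rfl fun s₂ F₂ q₂ s₃ F₃ u => ?_
      simp only [NExpr.eval, h7, (c₂.of_frame F').l j hj] at q₂
      rw [F₃.narr 4 rfl, q₂, Function.update_apply, hI, range_add_one, image_insert]
      by_cases h : u = I.l j <;> simp [h]
  have c₃ := c₂.of_frame F₃
  refine Ex.seq (B₁ := 1) (Ex.cstore hM (by decide)) fun s₄ F₄ q₄ => ?_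
  rw [F₃.carr 1 rfl, F₂.carr 1 rfl, F₁.carr 1 rfl, hc] at q₄
  simp only [NExpr.eval, CExpr.eval] at q₄
  have c₄ := c₃.of_frame F₄
  -- The truncated difference `v - u` is nonzero exactly for `u < v`, so each edge is counted once.
  set f : ℕ → ℕ → ℂ := fun u v => if (v - u) * I.a u v ≠ 0 then ((Real.sqrt 2 : ℝ) : ℂ)⁻¹ else 1
    with hf
  refine Ex.seq (Q₁ := fun s' => s'.carr 1 = Function.update (fun _ => 0) 0 I.norm) ?_
    fun s₅ F₅ q₅ => ?_
  · refine Ex.forLoop hM c₄.n (fun j s' => s'.carr 1 = Function.update (fun _ => 0) 0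
      (∏ u ∈ range j, ∏ v ∈ range I.n, f u v)) (by decide)
      rfl rfl (fun s' F' => ?_) (fun j s' F' hj h11 hI => ?_)
    · rw [F'.carr 1 rfl, q₄]; simp
    · have c' := c₄.of_frame F'
      refine (Ex.forLoop hM c'.n (fun k s' => s'.carr 1 = Function.update (fun _ => 0) 0
        ((∏ u ∈ range j, ∏ v ∈ range I.n, f u v) * ∏ v ∈ range k, f j v)) (by decide)
        rfl rfl (fun s'' F'' => ?_) (fun k s'' F'' hk h14 hI' => ?_)).mono le_rfl
        fun s₂ F₂ q₂ s₃ F₃ => ?_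
      · rw [F''.carr 1 rfl, hI]; simp
      · have c'' := c'.of_frame F''
        have e11 : s''.nvar 11 = j := by rw [F''.nvar 11 rfl, h11]
        refine Ex.branch hM (by decide) (fun h => ?_) (fun h => ?_)
        · simp only [NExpr.eval, h14, e11, c''.n, c''.a j hj k hk] at h
          refine (Ex.cstore hM (by decide)).mono le_rfl fun s₂ F₂ q₂ s₃ F₃ => ?_
          simp only [NExpr.eval, CExpr.eval, hI', Function.update_self,
            Function.update_idem] at q₂
          rw [F₃.carr 1 rfl, q₂, prod_range_succ, ← mul_assoc]
          simp only [hf, if_pos h]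
        · simp only [NExpr.eval, h14, e11, c''.n, c''.a j hj k hk] at h
          refine Ex.skip hM fun s₃ F₃ => ?_
          have hfk : f j k = 1 := by simp only [hf, h, ne_eq, not_true_eq_false, if_false]
          rw [F₃.carr 1 rfl, hI', prod_range_succ, hfk, mul_one]
      · rw [F₃.carr 1 rfl, q₂, prod_range_succ]
  have c₅ := c₄.of_frame F₅
  refine Ex.seq (B₁ := 1) (B₂ := 1) (Ex.nstore hM (by simp [NExpr.eval]) (by decide))
    fun s₆ F₆ q₆ => ?_
  rw [F₅.narr 8 rfl, F₄.narr 8 rfl, F₃.narr 8 rfl, F₂.narr 8 rfl, F₁.narr 8 rfl,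
    hn 8 (by omega)] at q₆
  simp only [NExpr.eval] at q₆
  refine (Ex.assign hM (by simp [NExpr.eval]) (by decide)).mono le_rfl fun s₇ F₇ q₇ => ?_
  simp only [NExpr.eval] at q₇
  have d6 : s₇.narr 6 = fun _ => 0 := by
    rw [F₇.narr 6 rfl, F₆.narr 6 rfl, F₅.narr 6 rfl, F₄.narr 6 rfl, F₃.narr 6 rfl, F₂.narr 6 rfl,
      F₁.narr 6 rfl, hn 6 (by omega)]
  have d7 : s₇.narr 7 = fun _ => 0 := by
    rw [F₇.narr 7 rfl, F₆.narr 7 rfl, F₅.narr 7 rfl, F₄.narr 7 rfl, F₃.narr 7 rfl, F₂.narr 7 rfl,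
      F₁.narr 7 rfl, hn 7 (by omega)]
  have d2 : s₇.nvar 2 = 0 := by
    rw [F₇.nvar 2 rfl, F₆.nvar 2 rfl, F₅.nvar 2 rfl, F₄.nvar 2 rfl, F₃.nvar 2 rfl, F₂.nvar 2 rfl,
      F₁.nvar 2 rfl, h2]
  have d8 : s₇.narr 8 = Function.update (fun _ => 0) 0 1 := by rw [F₇.narr 8 rfl, q₆]
  have d1 : s₇.carr 1 = Function.update (fun _ => 0) 0 I.norm := by
    rw [F₇.carr 1 rfl, F₆.carr 1 rfl, q₅]
  refine ⟨⟨(c₅.of_frame F₆).of_frame F₇, fun u hu => ?_, fun v => ?_⟩, ?_, ?_, ?_, ?_⟩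
  · rw [F₇.narr 3 rfl, F₆.narr 3 rfl, F₅.narr 3 rfl, F₄.narr 3 rfl, F₃.narr 3 rfl, q₂ u hu.le]
  · rw [F₇.narr 4 rfl, F₆.narr 4 rfl, F₅.narr 4 rfl, F₄.narr 4 rfl, q₃]
  · simp [d6]
  · simp [d2]
  · rw [d7, d8, d1, q₇]
    refine ⟨by simp, by simp, fun y => ?_, fun y => ?_⟩
    · simp [Function.update_apply]
    · by_cases hy : y = 0 <;> simp [Function.update_apply, table_empty, hy]
  · intro t ht _
    have : t ≠ 0 := by rintro rfl; simp at ht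
    rw [d7, d8, d1]
    refine ⟨by simp, by simp, fun y => ?_, fun y => ?_⟩ <;> simp [this]

/-- The alternative without any end occurs for a tree all of whose nodes are leaves. Variable 3 then
keeps its initial value 0, which is also a valid start. -/
theorem ex_findStart (hb : ∀ u v, I.b u v ≤ 1) (hm0 : 1 ≤ I.m) (hm : I.m < 2 ^ (2 * I.n + 1))
    {s : Memory} (hs : I.Prepared s) (h3 : s.nvar 3 = 0) :
    Ex (2 * I.n + 1) findStart s (I.m * (3 * I.m + 7) + 2) (fun s' => s'.nvar 3 < I.m ∧
      (I.IsEnd (s'.nvar 3) ∨ ∀ v < I.m, ¬ I.IsEnd v)) := by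
  have hM : 1 ≤ 2 * I.n + 1 := by omega
  have hB : I.m * (3 * I.m + 7) + 2 = I.m * ((1 + ((I.m * (1 + 2) + 2) + (1 + 1))) + 2) + 2 := by
    ring
  rw [hB, findStart]
  refine Ex.forLoop hM hs.m (fun j s' => s'.nvar 3 < I.m ∧
      (I.IsEnd (s'.nvar 3) ∨ ∀ v < j, ¬ I.IsEnd v)) (by decide)
      rfl rfl (fun s' F' => ?_) (fun j s' F' hj h15 hI => ?_)
  · rw [F'.nvar 3 rfl, h3]
    exact ⟨hm0, Or.inr fun v hv => by omega⟩
  · have c' := hs.of_frame F'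
    set f : ℕ → ℕ := fun w => I.b j w * (1 - if w ∈ (range I.n).image I.l then 1 else 0) with hf
    have hf1 : ∀ w, f w ≤ 1 := fun w => by
      have := hb j w
      simp only [hf]; split_ifs <;> omega
    refine (Ex.assign hM (by simp [NExpr.eval]) (by decide)).seq fun s₁ F₁ q₁ => ?_
    simp only [NExpr.eval] at q₁
    have c₁ := c'.of_frame F₁
    have e15 : s₁.nvar 15 = j := by rw [F₁.nvar 15 rfl, h15]
    refine Ex.seq (Q₁ := fun s' => s'.nvar 16 = ∑ w ∈ range I.m, f w) ?_ fun s₂ F₂ q₂ => ?_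
    · refine Ex.forLoop hM c₁.m (fun k s' => s'.nvar 16 = ∑ w ∈ range k, f w) (by decide)
        rfl rfl (fun s'' F'' => ?_) (fun k s'' F'' hk h14 hI' => ?_)
      · rw [F''.nvar 16 rfl, q₁]; simp
      · have c'' := c₁.of_frame F''
        have hle : ∑ w ∈ range (k + 1), f w ≤ k + 1 := by
          simpa using sum_le_card_nsmul (range (k + 1)) f 1 fun w _ => hf1 w
        have g15 : s''.nvar 15 = j := by rw [F''.nvar 15 rfl, e15]
        rw [sum_range_succ] at hle
        refine (Ex.assign hM ?_ (by decide)).mono le_rfl fun s₂ F₂ q₂ s₃ F₃ => ?_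
        · simp only [NExpr.eval, h14, g15, hI', c''.m, c''.leaf, c''.b j hj k hk]
          change ∑ w ∈ range k, f w + f k < _
          omega
        · simp only [NExpr.eval, h14, g15, hI', c''.m, c''.leaf, c''.b j hj k hk] at q₂
          rw [F₃.nvar 16 rfl, q₂, sum_range_succ]
    · have c₂ := c₁.of_frame F₂
      have e15' : s₂.nvar 15 = j := by rw [F₂.nvar 15 rfl, e15]
      have e3 : s₂.nvar 3 = s'.nvar 3 := by rw [F₂.nvar 3 rfl, F₁.nvar 3 rfl]
      refine Ex.branch hM (by decide) (fun h => ?_) (fun h => ?_)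
      · simp only [NExpr.eval, e15', q₂, c₂.leaf] at h
        have hend : I.IsEnd j := by
          constructor
          · intro hmem
            simp only [hmem, if_true] at h
            simp at h
          -- With truncated subtraction, `2 - ∑ f` is nonzero exactly when at most one neighbour is
          -- an inner node.
          · change ∑ w ∈ range I.m, f w ≤ 1
            by_contra hlt
            apply h
            rw [Nat.sub_eq_zero_of_le (m := ∑ w ∈ range I.m, f w) (by omega), mul_zero]
        refine (Ex.assign hM (by simp only [NExpr.eval, e15']; omega) (by decide)).mono le_rfl
          fun s₃ F₃ q₃ s₄ F₄ => ?_
        simp only [NExpr.eval, e15'] at q₃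
        rw [F₄.nvar 3 rfl, q₃]
        exact ⟨hj, Or.inl hend⟩
      · simp only [NExpr.eval, e15', q₂, c₂.leaf] at h
        have hend : ¬ I.IsEnd j := by
          rintro ⟨h1, h2⟩
          change ∑ w ∈ range I.m, f w ≤ 1 at h2
          simp only [h1, if_false] at h
          omega
        refine Ex.skip hM fun s₄ F₄ => ?_
        rw [F₄.nvar 3 rfl, e3]
        refine ⟨hI.1, hI.2.imp_right fun h v hv => ?_⟩
        rcases Nat.lt_succ_iff_lt_or_eq.1 hv with hv | rfl
        exacts [h v hv, hend]

end Contract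

namespace Contract

variable {I : Instance}

theorem ex_visitNode (ha : ∀ u v, I.a u v = I.a v u)
    (hl : ∀ x < I.n, I.l x < I.m) (hm : I.m < 2 ^ (2 * I.n + 1)) {R N : ℕ} {p lvl : ℕ → ℕ}
    (hL : I.Layout R N p lvl) {s : Memory} (hs : I.Prepared s) {c : ℂ} {i : ℕ} (hi : i < N)
    (hlev : I.Level c {x ∈ range I.n | lvl x < i} s) (h3 : s.nvar 3 = p i)
    (h5 : ∀ w, s.narr 5 w = if ∃ j < i, w = p j then 1 else 0) :
    Ex (2 * I.n + 1) visitNode s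
      (I.n * (8 * 2 ^ R * (6 * I.n + 27) + 9) + 4 * I.m + 7) (fun s' =>
      I.Level c {x ∈ range I.n | lvl x < i + 1} s' ∧ (i + 1 < N → s'.nvar 3 = p (i + 1)) ∧
      ∀ w, s'.narr 5 w = if ∃ j < i + 1, w = p j then 1 else 0) := by
  have hM : 1 ≤ 2 * I.n + 1 := by omega
  have hB : I.n * (8 * 2 ^ R * (6 * I.n + 27) + 9) + 4 * I.m + 7 =
      (I.n * ((8 * 2 ^ R * (6 * I.n + 27) + 6 + 1) + 2) + 2) + (1 + (1 + ((I.m * (1 + 1 + 2) + 2)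
        + 1))) := by ring
  have hpi := hL.node_lt i hi
  rw [hB, visitNode]
  refine Ex.seq (Q₁ := I.Level c {x ∈ range I.n | lvl x < i + 1}) ?_ fun s₁ F₁ q₁ => ?_
  · have hend : ({x ∈ range I.n | lvl x < i ∨ (lvl x = i ∧ x < I.n)} : Finset ℕ) =
        {x ∈ range I.n | lvl x < i + 1} := by
      refine filter_congr fun x hx => ?_
      have := mem_range.1 hx
      omega
    rw [← hend]
    refine Ex.forLoop hM hs.n (fun j s' => I.Level c {x ∈ range I.n | lvl x < i ∨
      (lvl x = i ∧ x < j)} s') (by decide) rfl rfl (fun s' F' => ?_) (fun j s' F' hj h7 hI => ?_)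
    · simpa using hlev.of_frame F'
    · have c' := hs.of_frame F'
      have e3 : s'.nvar 3 = p i := by rw [F'.nvar 3 rfl, h3]
      have hjX : j ∈ ({x ∈ range I.n | lvl x < i ∨ (lvl x = i ∧ x < j)} : Finset ℕ) ↔
          lvl j < i := by simp [hj]
      have hatt := hL.attached i hi j hj
      refine Ex.branch hM (by decide) (fun h => ?_) (fun h => ?_)
      · simp only [NExpr.eval, h7, e3, c'.l j hj, c'.m, c'.b _ (hl j hj) _ hpi, hI.done j hj] at h
        have hlt : ¬ lvl j < i := by
          intro h'
          rw [if_pos (hjX.2 h')] at h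
          simp at h
        have hlvl : lvl j = i := by
          rw [← hatt]
          by_contra hne
          push Not at hne
          apply h
          rw [hne.1]
          -- The sum of the two truncated differences is the distance of the two numbers, so one
          -- minus it tests equality. Equality matters only for a tree without inner nodes, where
          -- the start is itself a leaf.
          have : 1 - (I.l j - p i + (p i - I.l j)) = 0 := by have := hne.2; omega
          rw [this]; simp
        have hins : ({x ∈ range I.n | lvl x < i ∨ (lvl x = i ∧ x < j + 1)} : Finset ℕ) =
            insert j {x ∈ range I.n | lvl x < i ∨ (lvl x = i ∧ x < j)} := by
          ext x
          simp only [mem_filter, mem_insert, mem_range]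
          constructor
          · rintro ⟨h1, h2⟩
            by_cases hx : x = j
            · exact Or.inl hx
            · exact Or.inr ⟨h1, by omega⟩
          · rintro (rfl | ⟨h1, h2⟩)
            · exact ⟨hj, by omega⟩
            · exact ⟨h1, by omega⟩
        -- At most three spiders have been added since the node was reached with at most `2 ^ R`
        -- keys, hence the factor 8.
        have hcard : #(keys I.n I.a {x ∈ range I.n | lvl x < i ∨ (lvl x = i ∧ x < j)}) ≤
            8 * 2 ^ R := by
          have hun : ({x ∈ range I.n | lvl x < i ∨ (lvl x = i ∧ x < j)} : Finset ℕ) =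
              {x ∈ range I.n | lvl x = i ∧ x < j} ∪ {x ∈ range I.n | lvl x < i} := by
            rw [filter_or, union_comm]
          rw [hun]
          refine (card_keys_union_le _ _).trans (Nat.mul_le_mul ?_ (hL.card_keys_le i hi))
          refine (Nat.pow_le_pow_right (by norm_num) ?_ : _ ≤ 2 ^ 3)
          refine (card_le_card fun x => ?_).trans (hL.card_lvl_le i)
          simp only [mem_filter]
          tauto
        refine (ex_addSpider ha c' hI h7 hj (filter_subset _ _) (fun h' => hlt (hjX.1 h'))
          hcard).mono le_rfl fun s₂ F₂ q₂ s₃ F₃ => ?_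
        rw [hins]
        exact q₂.of_frame F₃
      · simp only [NExpr.eval, h7, e3, c'.l j hj, c'.m, c'.b _ (hl j hj) _ hpi, hI.done j hj] at h
        refine (Ex.skip hM (Q := fun s₂ => ∀ s₃, Frame (.assign 7 (.const 0)) s₂ s₃ → _)
          fun s₃ F₃ => ?_).mono (by omega) fun _ _ h => h
        have hne : lvl j ≠ i := by
          intro hlvl
          have h1 := hatt.2 hlvl
          have : ¬ lvl j < i := by omega
          rw [if_neg (fun h' => this (hjX.1 h'))] at h
          rcases h1 with h1 | h1
          · have : 0 < I.b (I.l j) (p i) := Nat.pos_of_ne_zero h1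
            omega
          · rw [h1] at h
            omega
        have hins : ({x ∈ range I.n | lvl x < i ∨ (lvl x = i ∧ x < j + 1)} : Finset ℕ) =
            {x ∈ range I.n | lvl x < i ∨ (lvl x = i ∧ x < j)} := by
          refine filter_congr fun x _ => ?_
          by_cases hx : x = j
          · subst hx; omega
          · omega
        rw [hins]
        exact hI.of_frame F₃
  · have c₁ := hs.of_frame F₁
    refine (Ex.nstore hM (by simp [NExpr.eval]) (by decide)).seq fun s₂ F₂ q₂ => ?_
    have e3 : s₁.nvar 3 = p i := by rw [F₁.nvar 3 rfl, h3]
    simp only [NExpr.eval, e3] at q₂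
    have c₂ := c₁.of_frame F₂
    have v5 : ∀ w, s₂.narr 5 w = if ∃ j < i + 1, w = p j then 1 else 0 := by
      intro w
      rw [q₂, Function.update_apply, F₁.narr 5 rfl, h5]
      by_cases h : w = p i
      · rw [if_pos h, if_pos ⟨i, by omega, h⟩]
      · rw [if_neg h]
        congr 1
        refine propext ⟨fun ⟨j, hj, h'⟩ => ⟨j, by omega, h'⟩, fun ⟨j, hj, h'⟩ => ⟨j, ?_, h'⟩⟩
        have : j ≠ i := by rintro rfl; exact h h'
        omega
    refine (Ex.assign hM (by simp only [NExpr.eval, F₂.nvar 3 rfl, e3]; omega)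
      (by decide)).seq fun s₃ F₃ _ => ?_
    have c₃ := c₂.of_frame F₃
    refine Ex.seq (Q₁ := fun s' => i + 1 < N → s'.nvar 4 = p (i + 1)) ?_ fun s₄ F₄ q₄ => ?_
    -- By `Layout.next` only `p (i + 1)` passes the test, so variable 4 is right once the scan has
    -- passed that node and is not changed to another node afterwards.
    · refine (Ex.forLoop hM c₃.m (fun j s' => i + 1 < N → p (i + 1) < j → s'.nvar 4 = p (i + 1))
        (by decide) rfl rfl (fun s' F' _ h => by omega) (fun j s' F' hj h14 hI => ?_)).mono le_rfl
        fun s₂ F₂ q₂ h => q₂ h (hL.node_lt _ h)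
      have c' := c₃.of_frame F'
      have g3 : s'.nvar 3 = p i := by rw [F'.nvar 3 rfl, F₃.nvar 3 rfl, F₂.nvar 3 rfl, e3]
      have g5 : s'.narr 5 j = if ∃ k < i + 1, j = p k then 1 else 0 := by
        rw [F'.narr 5 rfl, F₃.narr 5 rfl, v5]
      have hnext : i + 1 < N → (I.b (p i) j *
          ((1 - if j ∈ image I.l (range I.n) then 1 else 0) *
            (1 - if ∃ k < i + 1, j = p k then 1 else 0)) ≠ 0 ↔ j = p (i + 1)) := by
        intro hN
        rw [← hL.next i hN j hj, Nat.mul_ne_zero_iff, Nat.mul_ne_zero_iff]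
        refine and_congr Iff.rfl (and_congr ?_ ?_)
        · by_cases h : j ∈ image I.l (range I.n) <;> simp [h]
        · by_cases h : ∃ k < i + 1, j = p k
          · simp only [h, if_true]
            obtain ⟨k, hk, h⟩ := h
            simp only [Nat.sub_self, ne_eq, not_true_eq_false, false_iff, not_forall]
            exact ⟨k, hk, fun h' => h' h⟩
          · simp only [h, if_false]
            push Not at h
            simpa using h
      refine Ex.branch hM (by decide) (fun h => ?_) (fun h => ?_)
      · simp only [NExpr.eval, h14, g3, c'.leaf, c'.m, c'.b _ hpi _ hj, g5] at h
        refine (Ex.assign hM (by simp only [NExpr.eval, h14]; omega) (by decide)).mono le_rfl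
          fun s₂ F₂ q₂ s₃ F₃ hN _ => ?_
        simp only [NExpr.eval, h14] at q₂
        rw [F₃.nvar 4 rfl, q₂, (hnext hN).1 h]
      · simp only [NExpr.eval, h14, g3, c'.leaf, c'.m, c'.b _ hpi _ hj, g5] at h
        refine Ex.skip hM fun s₃ F₃ hN hlt => ?_
        rw [F₃.nvar 4 rfl]
        refine hI hN ?_
        have : j ≠ p (i + 1) := fun h' => (hnext hN).2 h' h
        omega
    -- At the last node nothing is known about variable 4 beyond its being a number in memory, which
    -- suffices for the size bound.
    · refine Ex.with_small fun hsm => ?_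
      refine (Ex.assign hM (by simpa only [NExpr.eval] using hsm.nvar 4) (by decide)).mono le_rfl fun s₅ F₅ q₅ => ?_
      simp only [NExpr.eval] at q₅
      refine ⟨(((q₁.of_frame F₂).of_frame F₃).of_frame F₄).of_frame F₅, fun h => ?_, fun w => ?_⟩
      · rw [q₅, q₄ h]
      · rw [F₅.narr 5 rfl, F₄.narr 5 rfl, F₃.narr 5 rfl, v5]

theorem ex_program (hn : 1 ≤ I.n) (ha : ∀ u v, I.a u v = I.a v u) (hb : ∀ u v, I.b u v ≤ 1)
    (hl : ∀ x < I.n, I.l x < I.m) (hm0 : 1 ≤ I.m) (hm : I.m ≤ 2 * I.n) {R : ℕ}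
    (hL : ∀ v < I.m, (I.IsEnd v ∨ ∀ w < I.m, ¬ I.IsEnd w) →
      ∃ N p lvl, I.Layout R N p lvl ∧ p 0 = v)
    {s : Memory} (hs : I.Holds s) (hv : ∀ i, 2 ≤ i → s.nvar i = 0)
    (hz : ∀ a, 3 ≤ a → s.narr a = fun _ => 0) (hc : s.carr 1 = fun _ => 0) :
    Ex (2 * I.n + 1) program s (500 * I.n ^ 3 * 2 ^ R) (fun s' =>
      s'.output = I.norm * ∑ Z ∈ (range I.n).powerset, weight I.a I.w Z) := by
  have hM : 1 ≤ 2 * I.n + 1 := by omega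
  have hpow := two_pow_add_one_lt (n := I.n) hn
  have hm' : I.m < 2 ^ (2 * I.n + 1) := hm.trans_lt
    ((Nat.lt_succ_self _).trans Nat.lt_two_pow_self)
  set V := I.n * (8 * 2 ^ R * (6 * I.n + 27) + 9) + 4 * I.m + 7 with hV
  -- The dominant cost is that of at most `n` nodes, each with a scan of `n` spiders and at most `8
  -- * 2 ^ R` keys at O(n) units per key.
  have hB : (4 * I.n ^ 2 + 10 * I.n + 10) + ((I.m * (3 * I.m + 7) + 2) +
      ((I.n * (V + 1) + 1) + 1)) ≤ 500 * I.n ^ 3 * 2 ^ R := by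
    have hr : 1 ≤ 2 ^ R := Nat.one_le_two_pow
    have h1 : I.m * (3 * I.m + 7) ≤ (2 * I.n) * (6 * I.n + 7) := Nat.mul_le_mul hm (by omega)
    have h2 : I.n * V ≤ I.n * (I.n * (8 * 2 ^ R * (6 * I.n + 27) + 9) + 8 * I.n + 7) :=
      Nat.mul_le_mul_left _ (by omega)
    have k1 : 1 ≤ I.n ^ 3 * 2 ^ R := Nat.one_le_iff_ne_zero.2 (by positivity)
    have k2 : I.n ^ 2 * 2 ^ R ≤ I.n ^ 3 * 2 ^ R :=
      Nat.mul_le_mul_right _ (Nat.pow_le_pow_right hn (by norm_num))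
    have k3 : I.n ^ 2 * 1 ≤ I.n ^ 2 * 2 ^ R := Nat.mul_le_mul_left _ hr
    have k4 : I.n ≤ I.n ^ 2 := Nat.le_self_pow (by norm_num) _
    have e1 : I.n * (I.n * (8 * 2 ^ R * (6 * I.n + 27) + 9) + 8 * I.n + 7) =
      48 * (I.n ^ 3 * 2 ^ R) + 216 * (I.n ^ 2 * 2 ^ R) + 17 * I.n ^ 2 + 7 * I.n := by ring
    have e2 : (2 * I.n) * (6 * I.n + 7) = 12 * I.n ^ 2 + 14 * I.n := by ring
    have e3 : I.n * (V + 1) = I.n * V + I.n := by ring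
    rw [e1] at h2
    rw [e2] at h1
    rw [e3, mul_assoc 500]
    omega
  rw [program]
  refine Ex.mono (Ex.seq (ex_prepare hn hs (hv 2 le_rfl) hz hc) fun s₁ F₁ ⟨c₁, l₁⟩ => ?_) hB
    fun _ _ h => h
  refine (ex_findStart hb hm0 hm' c₁ (by rw [F₁.nvar 3 rfl, hv 3 (by omega)])).seq
    fun s₂ F₂ ⟨h3, hend⟩ => ?_
  obtain ⟨N, p, lvl, hLay, hp0⟩ := hL _ h3 hend
  have c₂ := c₁.of_frame F₂
  have l₂ := l₁.of_frame F₂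
  have z5 : s₂.narr 5 = fun _ => 0 := by rw [F₂.narr 5 rfl, F₁.narr 5 rfl, hz 5 (by omega)]
  refine Ex.seq (Q₁ := I.Level I.norm (range I.n)) ?_ fun s₃ F₃ q₃ => ?_
  · refine (Ex.loop hM (by decide) I.n (fun i s' => i ≤ N ∧
      I.Level I.norm {x ∈ range I.n | lvl x < i} s' ∧ (i < N → s'.nvar 3 = p i) ∧
      ∀ w, s'.narr 5 w = if ∃ j < i, w = p j then 1 else 0) ?_ ?_).mono le_rfl ?_
    · refine ⟨by omega, by simpa using l₂, fun _ => hp0.symm, fun w => by simp [z5]⟩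
    · rintro i s₄ F₄ ⟨hiN, hlev, hp, h5⟩ hne
      have c₄ := c₂.of_frame F₄
      simp only [NExpr.eval, c₄.n, hlev.count] at hne
      -- After `N` levels every spider has been counted and the loop condition fails.
      have hi : i < N := by
        rcases hiN.lt_or_eq with h | h
        · exact h
        · exfalso
          apply hne
          have : ({x ∈ range I.n | lvl x < i} : Finset ℕ) = range I.n := by
            refine filter_true_of_mem fun x hx => ?_
            rw [h]; exact hLay.lvl_lt x (mem_range.1 hx)
          rw [this]; simp
      refine ⟨hi.trans_le hLay.length_le, ?_⟩
      exact (ex_visitNode ha hl hm' hLay c₄ hi hlev (hp hi) h5).mono le_rfl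
        fun s₅ F₅ h => ⟨hi, h⟩
    · rintro s₄ F₄ ⟨i, ⟨hiN, hlev, hp, h5⟩, hz⟩
      have c₄ : s₄.nvar 0 = I.n := by rw [F₄.nvar 0 rfl, c₂.n]
      simp only [NExpr.eval, c₄, hlev.count] at hz
      have : ({x ∈ range I.n | lvl x < i} : Finset ℕ) = range I.n :=
        eq_of_subset_of_card_le (filter_subset _ _) (by rw [card_range]; omega)
      rw [this] at hlev
      exact hlev
  · have c₃ : s₃.nvar 0 = I.n := by rw [F₃.nvar 0 rfl, c₂.n]
    refine (Ex.cstore hM (by decide)).mono le_rfl fun s₄ F₄ q₄ => ?_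
    -- Level `n`, key 0 has the address `0 * (n + 1) + n = n`, the cell read by the last
    -- instruction.
    have h := q₃.table.val 0
    rw [card_range, zero_mul, zero_add, table_range] at h
    simp only [NExpr.eval, CExpr.eval, c₃, h] at q₄
    rw [Memory.output, q₄, Function.update_self]

end Contract

/-! ### The scalar of a diagram as a sum over subsets -/

open Classical in
/-- The matrix of a relation on `Fin k`, with natural numbers as indices. -/
noncomputable def natMatrix {k : ℕ} (r : Fin k → Fin k → Prop) (u v : ℕ) : ℕ :=
  if ∃ i j : Fin k, (i : ℕ) = u ∧ (j : ℕ) = v ∧ r i j then 1 else 0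

open Classical in
theorem natMatrix_coe {k : ℕ} (r : Fin k → Fin k → Prop) (i j : Fin k) :
    natMatrix r i j = if r i j then 1 else 0 := by
  unfold natMatrix
  congr 1
  refine propext ⟨?_, fun h => ⟨i, j, rfl, rfl, h⟩⟩
  rintro ⟨i', j', h1, h2, h⟩
  rwa [Fin.ext h1, Fin.ext h2] at h

theorem natMatrix_le_one {k : ℕ} (r : Fin k → Fin k → Prop) (u v : ℕ) : natMatrix r u v ≤ 1 := by
  unfold natMatrix
  split_ifs <;> omega

theorem natMatrix_symm {k : ℕ} {r : Fin k → Fin k → Prop} (hr : ∀ i j, r i j → r j i) (u v : ℕ) :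
    natMatrix r u v = natMatrix r v u := by
  unfold natMatrix
  congr 1
  refine propext ⟨?_, ?_⟩ <;>
  · rintro ⟨i, j, h1, h2, h⟩
    exact ⟨j, i, h2, h1, hr _ _ h⟩

/-- The numerical data of a diagram and a decomposition. -/
noncomputable def Instance.of {n m : ℕ} (D : Diagram n)
    (T : BranchDecomposition (Fin n) (Fin m)) : Instance where
  n := n
  m := m
  a := natMatrix D.graph.Adj
  b := natMatrix T.tree.Adj
  l x := if h : x < n then ((T.leafEquiv ⟨x, h⟩ : Fin m) : ℕ) else 0
  w x := Complex.exp (Complex.I * (if h : x < n then D.phase ⟨x, h⟩ else 0 : ℝ))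

section Value

variable {n : ℕ} (D : Diagram n)

open Classical in
theorem zSpider_eq_sum {L : Type*} (a : ℝ) (x : L → Bool) :
    zSpider a x = ∑ b : Bool, (if b then Complex.exp (Complex.I * a) else 1) *
      (if ∀ l, x l = b then 1 else 0) := by
  simp [zSpider]
  ring

open Classical in
-- Each spider is a sum over the one bit shared by its legs. After expansion of the product, a
-- choice `z` of these bits determines the bits at all edge ends, so the sum over the latter
-- collapses.
theorem Diagram.value_eq_sum_assignments : D.value = ∑ z : Fin n → Bool,
    (∏ v, if z v then Complex.exp (Complex.I * D.phase v) else 1) *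
      ∏ d : D.graph.Dart with d.fst < d.snd, hadamard (z d.fst) (z d.snd) := by
  have h1 : ∀ x : D.graph.Dart → Bool,
      ∏ v : Fin n, zSpider (D.phase v) (fun l : {d : D.graph.Dart // d.fst = v} => x l) =
      ∑ z : Fin n → Bool, (∏ v, if z v then Complex.exp (Complex.I * D.phase v) else 1) *
        if x = (fun d => z d.fst) then 1 else 0 := by
    intro x
    simp only [zSpider_eq_sum, prod_univ_sum, Fintype.piFinset_univ, prod_mul_distrib]
    refine sum_congr rfl fun z _ => ?_
    congr 1
    by_cases h : x = fun d => z d.fst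
    · rw [if_pos h]
      refine prod_eq_one fun v _ => if_pos ?_
      rintro ⟨d, rfl⟩
      exact congrFun h d
    · rw [if_neg h]
      obtain ⟨d, hd⟩ := Function.ne_iff.1 h
      exact prod_eq_zero (mem_univ d.fst) (if_neg fun h' => hd (h' ⟨d, rfl⟩))
  rw [Diagram.value]
  simp only [h1, sum_mul]
  rw [sum_comm]
  refine sum_congr rfl fun z _ => ?_
  simp only [mul_assoc, ← mul_sum]
  congr 1
  simp

open Classical in
theorem Diagram.prod_edges (F : Fin n → Fin n → ℂ) :
    ∏ d : D.graph.Dart with d.fst < d.snd, F d.fst d.snd =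
      ∏ u, ∏ v, if u < v ∧ D.graph.Adj u v then F u v else 1 := by
  rw [← Fintype.prod_prod_type' (f := fun u v => if u < v ∧ D.graph.Adj u v then F u v else 1),
    ← prod_filter]
  refine prod_bij (fun d _ => d.toProd) ?_ ?_ ?_ ?_
  · intro d hd
    simpa [d.adj] using hd
  · intro d _ d' _ h
    exact SimpleGraph.Dart.ext _ _ h
  · intro p hp
    rw [mem_filter] at hp
    exact ⟨⟨p, hp.2.2⟩, by simpa using hp.2.1, rfl⟩
  · intro d _
    rfl

theorem weight_eq_prod (a : ℕ → ℕ → ℕ) (w : ℕ → ℂ) {Z : Finset ℕ} (hZ : Z ⊆ range n) :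
    weight a w Z = (∏ v : Fin n, if (v : ℕ) ∈ Z then w v else 1) *
      ∏ u : Fin n, ∏ v : Fin n,
        if (u : ℕ) < v ∧ (u : ℕ) ∈ Z ∧ (v : ℕ) ∈ Z then (-1) ^ a u v else 1 := by
  have hf : ∀ f : ℕ → ℂ, ∏ v ∈ Z, f v = ∏ v : Fin n, if (v : ℕ) ∈ Z then f v else 1 := by
    intro f
    rw [← prod_range (fun v => if v ∈ Z then f v else 1), ← prod_filter]
    congr 1
    ext x
    simp only [mem_filter, mem_range]
    exact ⟨fun h => ⟨mem_range.1 (hZ h), h⟩, fun h => h.2⟩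
  rw [weight, prod_mul_distrib, hf]
  congr 1
  rw [prod_comm, hf]
  refine prod_congr rfl fun v _ => ?_
  rw [prod_filter, hf]
  split_ifs with hv
  · refine prod_congr rfl fun u _ => ?_
    by_cases h1 : (u : ℕ) ∈ Z <;> by_cases h2 : (u : ℕ) < v <;> simp [h1, h2, hv]
  · simp [hv]

open Classical in
theorem Diagram.value_eq {m : ℕ} (T : BranchDecomposition (Fin n) (Fin m)) :
    D.value = (Instance.of D T).norm * ∑ Z ∈ (range n).powerset,
      weight (Instance.of D T).a (Instance.of D T).w Z := by
  rw [D.value_eq_sum_assignments, mul_sum]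
  -- Bit assignments correspond to their supports, and a Hadamard entry is 1/√2 times a sign that is
  -- negative exactly when both ends lie in the support.
  refine sum_nbij' (fun z => (univ.filter fun v => z v = true).map Fin.valEmbedding)
    (fun Z v => decide ((v : ℕ) ∈ Z)) ?_ ?_ ?_ ?_ ?_
  · intro z _
    rw [mem_powerset]
    intro x hx
    obtain ⟨v, _, rfl⟩ := mem_map.1 hx
    exact mem_range.2 v.2
  · simp
  · intro z _
    funext v
    simp [Fin.val_inj]
  · intro Z hZ
    rw [mem_powerset] at hZ
    ext x
    simp only [decide_eq_true_eq, mem_map, mem_filter, mem_univ, true_and, Fin.valEmbedding_apply]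
    exact ⟨fun ⟨v, h, e⟩ => e ▸ h, fun h => ⟨⟨x, mem_range.1 (hZ h)⟩, h, rfl⟩⟩
  · intro z _
    have hmem : ∀ v : Fin n, (v : ℕ) ∈ (univ.filter fun v => z v = true).map Fin.valEmbedding ↔
        z v = true := by
      intro v
      simp [Fin.val_inj]
    rw [D.prod_edges (fun u v => hadamard (z u) (z v)), weight_eq_prod (n := n) _ _ (by
      intro x hx
      obtain ⟨v, _, rfl⟩ := mem_map.1 hx
      exact mem_range.2 v.2), mul_left_comm]
    congr 1
    · refine prod_congr rfl fun v _ => ?_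
      simp only [hmem, Instance.of, v.2, dif_pos]
    · have hnorm : (Instance.of D T).norm = ∏ u : Fin n, ∏ v : Fin n,
          if u < v ∧ D.graph.Adj u v then ((Real.sqrt 2 : ℝ) : ℂ)⁻¹ else 1 := by
        rw [Instance.norm, show (Instance.of D T).n = n from rfl, prod_range]
        refine prod_congr rfl fun u _ => ?_
        rw [prod_range]
        refine prod_congr rfl fun v _ => ?_
        simp only [Instance.of, natMatrix_coe, Fin.lt_def]
        by_cases h1 : D.graph.Adj u v
        · simp [h1, Nat.sub_ne_zero_iff_lt]
        · simp [h1]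
      rw [hnorm, ← prod_mul_distrib]
      refine prod_congr rfl fun u _ => ?_
      rw [← prod_mul_distrib]
      refine prod_congr rfl fun v _ => ?_
      simp only [hmem, Instance.of, natMatrix_coe, Fin.lt_def, hadamard]
      by_cases h1 : D.graph.Adj u v <;> by_cases h2 : (u : ℕ) < v <;> cases hu : z u <;>
        cases hv : z v <;> simp [h1, h2]

end Value

/-! ### Linear branch-decompositions -/

/-- Reachability is always bounded from above in this way: by exhibiting a set closed under
adjacency. -/
theorem mem_of_reachable {W : Type*} {G : SimpleGraph W} {C : Set W}
    (hC : ∀ x ∈ C, ∀ y, G.Adj x y → y ∈ C) {u v : W} (h : G.Reachable u v) (hu : u ∈ C) : v ∈ C := by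
  obtain ⟨p⟩ := h
  induction p with
  | nil => exact hu
  | cons hadj _ ih => exact ih (hC _ hu _ hadj)

theorem IsLeaf.eq_of_adj {W : Type*} [Finite W] {T : SimpleGraph W} {v u u' : W} (h : IsLeaf T v)
    (hu : T.Adj v u) (hu' : T.Adj v u') : u = u' :=
  (Set.ncard_le_one (Set.toFinite _)).1 h u hu u' hu'

theorem cutRank_le_one {V : Type*} [Fintype V] (G : SimpleGraph V) {X : Set V}
    (hX : (Xᶜ).Subsingleton) : cutRank G X ≤ 1 := by
  classical
  refine (Matrix.rank_le_card_width _).trans ?_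
  rw [Fintype.card_le_one_iff_subsingleton]
  exact hX.coe_sort

namespace BranchDecomposition

variable {V W : Type*} (T : BranchDecomposition V W)

theorem edgeRank_le_width [Fintype V] [Fintype W] (G : SimpleGraph V) {u v : W}
    (h : T.tree.Adj u v) : T.edgeRank G u v ≤ T.width G := by
  rw [width]
  exact @Finset.le_sup _ _ _ _ _ (fun d : T.tree.Dart => T.edgeRank G d.fst d.snd)
    ⟨(u, v), h⟩ (@mem_univ _ (_) _)

/-- The nodes `p 0, …, p (k - 1)` are the nodes that are not leaves, and form a path. -/
structure IsSpine (k : ℕ) (p : ℕ → W) : Prop where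
  notLeaf : ∀ i < k, ¬ IsLeaf T.tree (p i)
  inj : ∀ i < k, ∀ j < k, p i = p j → i = j
  surj : ∀ v, ¬ IsLeaf T.tree v → ∃ i < k, p i = v
  adj : ∀ i < k, ∀ j < k, T.tree.Adj (p i) (p j) ↔ i + 1 = j ∨ j + 1 = i

variable {T}

theorem IsLinear.exists_isSpine (h : T.IsLinear) : ∃ k p, T.IsSpine k p := by
  obtain ⟨k, ⟨φ⟩⟩ := h
  obtain ⟨w⟩ := T.isTree.connected.nonempty
  -- The node `w` is a dummy value for indices outside the path.
  refine ⟨k, fun i => if h : i < k then (φ.symm ⟨i, h⟩ : W) else w, ?_, ?_, ?_, ?_⟩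
  · intro i hi
    simp only [hi, dif_pos]
    exact (φ.symm ⟨i, hi⟩).2
  · intro i hi j hj hij
    simp only [hi, hj, dif_pos] at hij
    simpa using φ.symm.injective (Subtype.ext hij)
  · intro v hv
    refine ⟨φ ⟨v, hv⟩, (φ ⟨v, hv⟩).2, ?_⟩
    simp
  · intro i hi j hj
    simp only [hi, hj, dif_pos]
    rw [← SimpleGraph.pathGraph_adj (u := ⟨i, hi⟩) (v := ⟨j, hj⟩), ← φ.symm.map_adj_iff]
    rfl

namespace IsSpine

variable {k : ℕ} {p : ℕ → W}

theorem reverse (h : T.IsSpine k p) : T.IsSpine k (fun i => p (k - 1 - i)) := by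
  refine ⟨fun i hi => h.notLeaf _ (by omega), fun i hi j hj hij => ?_, fun v hv => ?_,
    fun i hi j hj => ?_⟩
  · have := h.inj _ (by omega) _ (by omega) hij
    omega
  · obtain ⟨i, hi, rfl⟩ := h.surj v hv
    exact ⟨k - 1 - i, by omega, by congr 1; omega⟩
  · rw [h.adj _ (by omega) _ (by omega)]
    omega

variable [Finite W]

/-- An inner node has degree 3, but only its predecessor and successor on the path can be inner
neighbours. -/
theorem exists_leaf_adj (h : T.IsSpine k p) {i : ℕ} (hi : i < k) :
    ∃ u, T.tree.Adj (p i) u ∧ IsLeaf T.tree u := by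
  by_contra hcon
  push Not at hcon
  have hsub : T.tree.neighborSet (p i) ⊆ {p (i - 1), p (i + 1)} := by
    intro u hu
    obtain ⟨j, hj, rfl⟩ := h.surj u (hcon u hu)
    rcases (h.adj i hi j hj).1 hu with rfl | rfl
    · exact Or.inr rfl
    · exact Or.inl rfl
  have h1 := Set.ncard_le_ncard hsub (Set.toFinite _)
  have h2 := Set.ncard_insert_le (p (i - 1)) {p (i + 1)}
  rw [Set.ncard_singleton] at h2
  have h3 := T.degree_eq_three _ (h.notLeaf i hi)
  omega

/-- Otherwise the leaf and its neighbours are all leaves and form a closed set, which by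
connectedness contains `p 0`. -/
theorem exists_adj_of_isLeaf (h : T.IsSpine k p) (hk : 0 < k) {l : W} (hl : IsLeaf T.tree l) :
    ∃ i < k, T.tree.Adj l (p i) := by
  by_contra hcon
  push Not at hcon
  have hleaf : ∀ u, T.tree.Adj l u → IsLeaf T.tree u := by
    intro u hu
    by_contra hu'
    obtain ⟨i, hi, rfl⟩ := h.surj u hu'
    exact hcon i hi hu
  have hC : p 0 ∈ insert l (T.tree.neighborSet l) := by
    refine mem_of_reachable ?_ (T.isTree.connected.preconnected l (p 0)) (Set.mem_insert _ _)
    rintro x (rfl | hx) y hxy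
    · exact Or.inr hxy
    · exact Or.inl ((hleaf x hx).eq_of_adj hxy hx.symm)
  rcases hC with hC | hC
  · exact h.notLeaf 0 hk (hC ▸ hl)
  · exact h.notLeaf 0 hk (hleaf _ hC)

/-- Deleting an edge of the spine separates the leaves by their position on the spine. -/
theorem side_eq (h : T.IsSpine k p) {i : ℕ} (hi : i + 1 < k) {lvl : V → ℕ}
    (hlvl : ∀ x, lvl x < k ∧ T.tree.Adj (T.leafEquiv x) (p (lvl x))) :
    T.side (p i) (p (i + 1)) = {x | lvl x < i + 1} := by
  set T' := T.tree.deleteEdges {s(p i, p (i + 1))} with hT'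
  have hadj' : ∀ u v, T'.Adj u v ↔ T.tree.Adj u v ∧ s(u, v) ≠ s(p i, p (i + 1)) := by
    intro u v
    simp [hT', SimpleGraph.deleteEdges_adj]
  ext x
  obtain ⟨hx, hxadj⟩ := hlvl x
  have hxleaf := (T.leafEquiv x).2
  change T'.Reachable (p i) (T.leafEquiv x) ↔ lvl x < i + 1
  constructor
  · intro hr
    -- The spine nodes up to `p i` and the leaves attached to them are closed under adjacency once
    -- the edge to `p (i + 1)` is gone.
    have hC : ((T.leafEquiv x : W)) ∈ {w : W | (∃ j < i + 1, w = p j) ∨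
        (IsLeaf T.tree w ∧ ∃ j < i + 1, T.tree.Adj w (p j))} := by
      refine mem_of_reachable ?_ hr (Or.inl ⟨i, by omega, rfl⟩)
      rintro w (⟨j, hj, rfl⟩ | ⟨hw, j, hj, hwj⟩) y hy
      · rw [hadj'] at hy
        by_cases hyl : IsLeaf T.tree y
        · exact Or.inr ⟨hyl, j, hj, hy.1.symm⟩
        · obtain ⟨j', hj', rfl⟩ := h.surj y hyl
          refine Or.inl ⟨j', ?_, rfl⟩
          rcases (h.adj j (by omega) j' hj').1 hy.1 with h1 | h1
          · by_contra hlt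
            apply hy.2
            rw [show j = i by omega, show j' = i + 1 by omega]
          · omega
      · exact Or.inl ⟨j, hj, hw.eq_of_adj ((hadj' _ _).1 hy).1 hwj⟩
    rcases hC with ⟨j, hj, hw⟩ | ⟨_, j, hj, hwj⟩
    · exact absurd (hw ▸ hxleaf) (h.notLeaf j (by omega))
    · have := h.inj _ (by omega) _ hx (hxleaf.eq_of_adj hwj hxadj)
      omega
  · intro hlt
    have hne : ∀ u v, u ≠ p (i + 1) → v ≠ p (i + 1) → s(u, v) ≠ s(p i, p (i + 1)) := by
      intro u v h1 h2 h3
      rcases Sym2.eq_iff.1 h3 with ⟨_, h3⟩ | ⟨h3, _⟩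
      exacts [h2 h3, h1 h3]
    have hpne : ∀ j ≤ i, p j ≠ p (i + 1) := by
      intro j hj h'
      have := h.inj j (by omega) (i + 1) hi h'
      omega
    -- Conversely, the walk down the spine from `p i` never meets `p (i + 1)`, so it survives the
    -- deletion.
    have hreach : ∀ d ≤ i, T'.Reachable (p i) (p (i - d)) := by
      intro d
      induction d with
      | zero => intro _; rfl
      | succ d ih =>
        intro hd
        refine (ih (by omega)).trans (SimpleGraph.Adj.reachable ?_)
        rw [hadj']
        refine ⟨(h.adj _ (by omega) _ (by omega)).2 (Or.inr (by omega)),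
          hne _ _ (hpne _ (by omega)) (hpne _ (by omega))⟩
    have h1 := hreach (i - lvl x) (by omega)
    rw [show i - (i - lvl x) = lvl x by omega] at h1
    refine h1.trans (SimpleGraph.Adj.reachable ?_)
    rw [hadj']
    refine ⟨hxadj.symm, hne _ _ (hpne _ (by omega)) ?_⟩
    intro h'
    exact h.notLeaf (i + 1) hi (h' ▸ hxleaf)

end IsSpine

/-- Deleting the edge at a leaf disconnects nothing but that leaf, so the cut matrix has at most one
column. -/
theorem edgeRank_le_one [Fintype V] [Finite W] (G : SimpleGraph V) {v u : W}
    (huv : T.tree.Adj v u) (hu : IsLeaf T.tree u) : T.edgeRank G v u ≤ 1 := by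
  refine cutRank_le_one G ?_
  have hmain : ∀ w, w = u ∨ (T.tree.deleteEdges {s(v, u)}).Reachable v w := by
    intro w
    refine mem_of_reachable (C := {w | w = u ∨ (T.tree.deleteEdges {s(v, u)}).Reachable v w})
      ?_ (T.isTree.connected.preconnected v w) (Or.inr (SimpleGraph.Reachable.refl _))
    rintro x hx y hxy
    by_cases hy : y = u
    · exact Or.inl hy
    by_cases hxu : x = u
    · subst hxu
      rw [hu.eq_of_adj hxy huv.symm]
      exact Or.inr (SimpleGraph.Reachable.refl _)
    · refine Or.inr ((hx.resolve_left hxu).trans (SimpleGraph.Adj.reachable ?_))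
      refine SimpleGraph.deleteEdges_adj.2 ⟨hxy, fun h => ?_⟩
      rcases Sym2.eq_iff.1 (Set.mem_singleton_iff.1 h) with ⟨_, h⟩ | ⟨h, _⟩
      exacts [hy h, hxu h]
  intro x hx y hy
  have h1 := (hmain (T.leafEquiv x)).resolve_right hx
  have h2 := (hmain (T.leafEquiv y)).resolve_right hy
  exact T.leafEquiv.injective (Subtype.ext (h1.trans h2.symm))

theorem IsLinear.nodeWeight_le [Fintype V] [Fintype W] (h : T.IsLinear) (G : SimpleGraph V)
    (v : W) : T.nodeWeight G v ≤ T.width G + 1 := by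
  classical
  unfold nodeWeight
  split_ifs with hv
  · omega
  · obtain ⟨k, p, hp⟩ := h.exists_isSpine
    obtain ⟨i, hi, rfl⟩ := hp.surj v hv
    obtain ⟨u, hu, hul⟩ := hp.exists_leaf_adj hi
    obtain ⟨u', hu', hne⟩ := Set.exists_ne_of_one_lt_ncard
      (show 1 < (T.tree.neighborSet (p i)).ncard by rw [T.degree_eq_three _ hv]; omega) u
    refine (Nat.sInf_le (m := T.edgeRank G (p i) u + T.edgeRank G (p i) u') ?_).trans ?_
    · exact ⟨u, u', hu, hu', hne.symm, rfl⟩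
    have h1 := T.edgeRank_le_width G hu'
    have h2 := T.edgeRank_le_one G hu hul
    omega

end BranchDecomposition

/-! ### Cut-rank bounds the number of keys -/

/-- The parity vector of a subset of `X` is the image of its indicator vector under the transposed
cut matrix. It lies in a space over the field of two elements whose dimension is the cut-rank. -/
theorem card_keys_le_two_pow_cutRank {n : ℕ} (G : SimpleGraph (Fin n)) (X : Set (Fin n))
    {S : Finset ℕ} (hS : ∀ x : Fin n, (x : ℕ) ∈ S ↔ x ∈ X) (hSn : S ⊆ range n) :
    #(keys n (natMatrix G.Adj) S) ≤ 2 ^ cutRank G X := by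
  classical
  rw [cutRank, ← Matrix.rank_transpose]
  set A : Matrix X (Xᶜ : Set (Fin n)) (ZMod 2) := (G.adjMatrix (ZMod 2)).submatrix
    (fun i : X => (i : Fin n)) (fun j : (Xᶜ : Set (Fin n)) => (j : Fin n)) with hA
  rw [Matrix.rank]
  set U := LinearMap.range A.transpose.mulVecLin with hU
  have hcard : 2 ^ Module.finrank (ZMod 2) U = Nat.card U := by
    rw [Module.natCard_eq_pow_finrank (K := ZMod 2), Nat.card_zmod]
  refine le_of_le_of_eq ?_ hcard.symm
  -- Packs a vector indexed by the complement of `X` into a number, with digit 0 at the positions in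
  -- `X`, as in `key`.
  set φ : U → ℕ := fun f => packBits n fun u =>
    if h : ∃ hu : u < n, (⟨u, hu⟩ : Fin n) ∈ Xᶜ then (f.1 ⟨⟨u, h.1⟩, h.2⟩).val else 0 with hφ
  have hsub : (keys n (natMatrix G.Adj) S : Set ℕ) ⊆ Set.range φ := by
    intro y hy
    obtain ⟨Z, hZ, rfl⟩ := mem_image.1 (mem_coe.1 hy)
    rw [mem_powerset] at hZ
    set z : X → ZMod 2 := fun i => if ((i : Fin n) : ℕ) ∈ Z then 1 else 0 with hz
    refine ⟨⟨A.transpose.mulVecLin z, z, rfl⟩, packBits_congr fun u hu => ?_⟩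
    by_cases huS : u ∈ S
    · have : ¬ ∃ hu : u < n, (⟨u, hu⟩ : Fin n) ∈ Xᶜ := by
        rintro ⟨hu, h⟩
        exact h ((hS ⟨u, hu⟩).1 huS)
      rw [dif_neg this, if_pos huS]
    · have huX : (⟨u, hu⟩ : Fin n) ∈ Xᶜ := fun h => huS ((hS ⟨u, hu⟩).2 h)
      rw [dif_pos ⟨hu, huX⟩, if_neg huS, ← ZMod.val_natCast]
      congr 1
      change ∑ i : X, A.transpose ⟨⟨u, hu⟩, huX⟩ i * z i = _
      have h1 : ∀ i : X, A.transpose ⟨⟨u, hu⟩, huX⟩ i * z i = (fun v : Fin n =>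
          if (v : ℕ) ∈ Z then ((natMatrix G.Adj v u : ℕ) : ZMod 2) else 0) i := by
        intro i
        have h2 := natMatrix_coe G.Adj i ⟨u, hu⟩
        simp only at h2
        simp only [hA, hz, Matrix.transpose_apply, Matrix.submatrix_apply,
          SimpleGraph.adjMatrix_apply, h2]
        split_ifs <;> simp
      rw [sum_congr rfl fun i _ => h1 i, ← sum_subtype (univ.filter fun v => v ∈ X) (by simp)
        (fun v : Fin n => if (v : ℕ) ∈ Z then ((natMatrix G.Adj v u : ℕ) : ZMod 2) else 0),
        sum_filter, Nat.cast_sum]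
      have h3 : ∑ v ∈ Z, ((natMatrix G.Adj v u : ℕ) : ZMod 2) =
          ∑ v : Fin n, if (v : ℕ) ∈ Z then ((natMatrix G.Adj v u : ℕ) : ZMod 2) else 0 := by
        rw [← sum_range fun v => if v ∈ Z then ((natMatrix G.Adj v u : ℕ) : ZMod 2) else 0,
          ← sum_filter]
        congr 1
        ext x
        simp only [mem_filter]
        exact ⟨fun h => ⟨hSn (hZ h), h⟩, fun h => h.2⟩
      rw [h3]
      refine sum_congr rfl fun v _ => ?_
      by_cases hv : (v : ℕ) ∈ Z
      · rw [if_pos ((hS v).1 (hZ hv))]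
      · simp [hv]
  have h1 := Set.ncard_le_ncard hsub (Set.toFinite _)
  rw [Set.ncard_coe_finset] at h1
  refine h1.trans ?_
  rw [← Set.image_univ, ← Set.ncard_univ U]
  exact Set.ncard_image_le (Set.toFinite _)

/-! ### Layouts of linear decompositions -/

namespace BranchDecomposition

variable {n m : ℕ} {T : BranchDecomposition (Fin n) (Fin m)} (D : Diagram n)

theorem mem_image_leaf_iff (v : Fin m) :
    (v : ℕ) ∈ (range (Instance.of D T).n).image (Instance.of D T).l ↔ IsLeaf T.tree v := by
  simp only [mem_image, mem_range, Instance.of]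
  constructor
  · rintro ⟨x, hx, h⟩
    rw [dif_pos hx] at h
    exact Fin.ext h ▸ (T.leafEquiv ⟨x, hx⟩).2
  · intro h
    refine ⟨T.leafEquiv.symm ⟨v, h⟩, (T.leafEquiv.symm ⟨v, h⟩).2, ?_⟩
    simp

open Classical in
theorem isEnd_iff (v : Fin m) : (Instance.of D T).IsEnd v ↔ ¬ IsLeaf T.tree v ∧
    #{w | T.tree.Adj v w ∧ ¬ IsLeaf T.tree w} ≤ 1 := by
  rw [Instance.IsEnd, mem_image_leaf_iff]
  refine and_congr Iff.rfl ?_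
  rw [show (Instance.of D T).m = m from rfl, sum_range, card_filter]
  simp only [mem_image_leaf_iff]
  have : ∀ w : Fin m, (Instance.of D T).b v w * (1 - if IsLeaf T.tree w then 1 else 0) =
      if T.tree.Adj v w ∧ ¬ IsLeaf T.tree w then 1 else 0 := by
    intro w
    simp only [Instance.of, natMatrix_coe]
    by_cases h1 : T.tree.Adj v w <;> by_cases h2 : IsLeaf T.tree w <;> simp [h1, h2]
  simp only [this]

namespace IsSpine

variable {k : ℕ} {p : ℕ → Fin m}

theorem isEnd_iff (h : T.IsSpine k p) {i : ℕ} (hi : i < k) :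
    (Instance.of D T).IsEnd (p i) ↔ i = 0 ∨ i + 1 = k := by
  classical
  rw [BranchDecomposition.isEnd_iff, card_le_one]
  simp only [mem_filter, mem_univ, true_and]
  constructor
  · rintro ⟨_, h2⟩
    by_contra hcon
    push Not at hcon
    have := h.inj _ (by omega) _ (by omega) (h2 (p (i - 1))
      ⟨(h.adj _ hi _ (by omega)).2 (by omega), h.notLeaf _ (by omega)⟩ (p (i + 1))
      ⟨(h.adj _ hi _ (by omega)).2 (by omega), h.notLeaf _ (by omega)⟩)
    omega
  · intro hend
    refine ⟨h.notLeaf i hi, ?_⟩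
    rintro u ⟨hu, hul⟩ v ⟨hv, hvl⟩
    obtain ⟨j, hj, rfl⟩ := h.surj u hul
    obtain ⟨j', hj', rfl⟩ := h.surj v hvl
    have h1 := (h.adj i hi j hj).1 hu
    have h2 := (h.adj i hi j' hj').1 hv
    congr 1
    omega

theorem exists_lvl (h : T.IsSpine k p) (hk : 0 < k) : ∃ lvl : Fin n → ℕ,
    ∀ x, lvl x < k ∧ T.tree.Adj (T.leafEquiv x) (p (lvl x)) := by
  choose f hf using fun x => h.exists_adj_of_isLeaf hk (T.leafEquiv x).2
  exact ⟨f, hf⟩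

/-- Every spine node has a leaf of its own, since a leaf has only one neighbour. Together with
`card_le` this makes the tree linear in the number of spiders. -/
theorem length_le (h : T.IsSpine k p) : k ≤ n := by
  choose f hf using fun i : Fin k => h.exists_leaf_adj i.2
  have hinj : Function.Injective fun i : Fin k => T.leafEquiv.symm ⟨f i, (hf i).2⟩ := by
    intro i j hij
    have hij' : f i = f j := by simpa using hij
    have h1 := (hf i).2.eq_of_adj (hf i).1.symm (hij' ▸ (hf j).1.symm)
    exact Fin.ext (h.inj i i.2 j j.2 h1)
  simpa using Fintype.card_le_of_injective _ hinj

theorem card_le (h : T.IsSpine k p) : m ≤ n + k := by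
  have hsurj : Function.Surjective (Sum.elim (fun x : Fin n => (T.leafEquiv x : Fin m))
      (fun i : Fin k => p i)) := by
    intro v
    by_cases hv : IsLeaf T.tree v
    · exact ⟨Sum.inl (T.leafEquiv.symm ⟨v, hv⟩), by simp⟩
    · obtain ⟨i, hi, rfl⟩ := h.surj v hv
      exact ⟨Sum.inr ⟨i, hi⟩, rfl⟩
  simpa using Fintype.card_le_of_surjective _ hsurj

theorem layout (h : T.IsSpine k p) (hk : 0 < k) :
    ∃ lvl, (Instance.of D T).Layout (T.width D.graph) k (fun i => p i) lvl := by
  classical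
  obtain ⟨f, hf⟩ := h.exists_lvl hk
  have hfx : ∀ (x : Fin n) (i : ℕ), i < k → (T.tree.Adj (T.leafEquiv x) (p i) ↔ f x = i) := by
    intro x i hi
    constructor
    · intro hadj
      exact h.inj _ (hf x).1 _ hi ((T.leafEquiv x).2.eq_of_adj (hf x).2 hadj)
    · rintro rfl
      exact (hf x).2
  refine ⟨fun x => if hx : x < n then f ⟨x, hx⟩ else 0, h.length_le, fun i _ => (p i).2, ?_, ?_,
    ?_, ?_, ?_⟩
  · intro x hx
    have hx : x < n := hx
    simp only [hx, dif_pos]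
    exact (hf _).1
  · intro i hi x hx
    have hx : x < n := hx
    simp only [hx, dif_pos, ← hfx ⟨x, hx⟩ i hi, Instance.of, natMatrix_coe]
    have hne : (T.leafEquiv ⟨x, hx⟩ : Fin m) ≠ p i := fun h' =>
      h.notLeaf i hi (h' ▸ (T.leafEquiv ⟨x, hx⟩).2)
    simp [Fin.val_inj, hne]
  · intro i hi w hw
    have hw : w < m := hw
    have e1 := mem_image_leaf_iff (T := T) D ⟨w, hw⟩
    have e2 := natMatrix_coe T.tree.Adj (p i) ⟨w, hw⟩
    simp only at e1 e2
    rw [e1, show (Instance.of D T).b = natMatrix T.tree.Adj from rfl, e2]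
    have e3 : ∀ j, w = (p j : ℕ) ↔ (⟨w, hw⟩ : Fin m) = p j := fun j => by rw [Fin.ext_iff]
    simp only [e3, ne_eq, ite_eq_right_iff, one_ne_zero, imp_false, not_not]
    constructor
    · rintro ⟨h1, h2, h3⟩
      obtain ⟨j, hj, hjw⟩ := h.surj _ h2
      rw [← hjw] at h1 h3 ⊢
      rcases (h.adj i (by omega) j hj).1 h1 with h4 | h4
      · rw [h4]
      · exact absurd rfl (h3 j (by omega))
    · intro hw'
      rw [hw']
      refine ⟨(h.adj _ (by omega) _ hi).2 (Or.inl rfl), h.notLeaf _ hi, fun j hj h' => ?_⟩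
      have := h.inj _ hi _ (by omega) h'
      omega
  · intro i
    by_cases hi : i < k
    · have h3 := T.degree_eq_three _ (h.notLeaf i hi)
      rw [← h3, ← Set.ncard_coe_finset]
      -- The leaves of the spiders at level `i` are distinct neighbours of `p i`, which has three.
      refine Set.ncard_le_ncard_of_injOn
        (fun x => if hx : x < n then (T.leafEquiv ⟨x, hx⟩ : Fin m) else p i) ?_ ?_ (Set.toFinite _)
      · intro x hx
        obtain ⟨hx, hl⟩ := mem_filter.1 (mem_coe.1 hx)
        have hx : x < n := mem_range.1 hx
        simp only [hx, dif_pos] at hl ⊢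
        exact ((hfx ⟨x, hx⟩ i hi).2 hl).symm
      · intro x hx y hy hxy
        have hx : x < n := mem_range.1 (mem_filter.1 (mem_coe.1 hx)).1
        have hy : y < n := mem_range.1 (mem_filter.1 (mem_coe.1 hy)).1
        simp only [hx, hy, dif_pos] at hxy
        simpa using T.leafEquiv.injective (Subtype.ext hxy)
    · rw [filter_false_of_mem]
      · simp
      · intro x hx
        have hx : x < n := mem_range.1 hx
        simp only [hx, dif_pos]
        have := (hf ⟨x, hx⟩).1
        omega
  · intro i hi
    -- At level 0 nothing has been summed out and 0 is the only key; at each later level the treated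
    -- set is one side of a spine edge.
    rcases Nat.eq_zero_or_pos i with rfl | hpos
    · simpa using Nat.one_le_two_pow
    · obtain ⟨i, rfl⟩ : ∃ j, i = j + 1 := ⟨i - 1, by omega⟩
      have hside := h.side_eq hi hf
      have hw := T.edgeRank_le_width D.graph ((h.adj i (by omega) (i + 1) hi).2 (Or.inl rfl))
      refine (card_keys_le_two_pow_cutRank D.graph (T.side (p i) (p (i + 1))) ?_
        (filter_subset _ _)).trans (Nat.pow_le_pow_right (by norm_num) hw)
      intro x
      rw [hside]
      have hx : (x : ℕ) ∈ range (Instance.of D T).n := mem_range.2 x.2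
      rw [mem_filter, Set.mem_ofPred_eq, dif_pos x.2]
      exact and_iff_right hx

end IsSpine

/-- If all nodes of the tree are leaves, they are all at any one of them. -/
theorem layout_of_forall_isLeaf (h : ∀ v, IsLeaf T.tree v) (v : Fin m) :
    (Instance.of D T).Layout (T.width D.graph) 1 (fun _ => v) (fun _ => 0) := by
  classical
  have hall : ∀ w, w ∈ insert v (T.tree.neighborSet v) := by
    intro w
    refine mem_of_reachable ?_ (T.isTree.connected.preconnected v w) (Set.mem_insert _ _)
    rintro x (rfl | hx) y hxy
    · exact Or.inr hxy
    · exact Or.inl ((h x).eq_of_adj hxy hx.symm)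
  -- A connected graph in which every node has at most one neighbour has at most two nodes, so at
  -- most two spiders share the single level.
  have hm : m ≤ 2 := by
    have h1 := Set.ncard_le_ncard (fun w (_ : w ∈ Set.univ) => hall w) (Set.toFinite _)
    have h2 := Set.ncard_insert_le v (T.tree.neighborSet v)
    have h3 : (T.tree.neighborSet v).ncard ≤ 1 := h v
    rw [Set.ncard_univ, Nat.card_fin] at h1
    omega
  have hnm : n ≤ m := by
    have hinj : Function.Injective fun x => (T.leafEquiv x : Fin m) :=
      Subtype.val_injective.comp T.leafEquiv.injective
    simpa using Fintype.card_le_of_injective _ hinj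
  refine ⟨?_, fun _ _ => v.2, fun _ _ => Nat.one_pos, ?_, fun i hi => by omega, ?_, ?_⟩
  · exact Nat.one_le_iff_ne_zero.2 (Nat.pos_iff_ne_zero.1 (T.leafEquiv.symm ⟨v, h v⟩).pos)
  · intro i hi x hx
    have hx : x < n := hx
    obtain rfl : i = 0 := by omega
    rw [eq_self_iff_true, iff_true]
    simp only [Instance.of, hx, dif_pos, natMatrix_coe]
    rcases hall (T.leafEquiv ⟨x, hx⟩) with h' | h'
    · exact Or.inr (by rw [h'])
    · refine Or.inl ?_
      rw [if_pos h'.symm]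
      exact Nat.one_ne_zero
  · intro i
    refine (card_filter_le _ _).trans ?_
    rw [card_range]
    exact (hnm.trans hm).trans (by norm_num)
  · intro i hi
    simpa [show i = 0 by omega] using Nat.one_le_two_pow

/-- The search may return either end of the spine, so the spine is reversed if necessary. If there
is no inner node, any node serves as a path of length one. -/
theorem IsLinear.exists_layout (h : T.IsLinear) (v : ℕ) (hv : v < m)
    (hend : (Instance.of D T).IsEnd v ∨ ∀ w < m, ¬ (Instance.of D T).IsEnd w) :
    ∃ N p lvl, (Instance.of D T).Layout (T.width D.graph) N p lvl ∧ p 0 = v := by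
  obtain ⟨k, p, hp⟩ := h.exists_isSpine
  rcases Nat.eq_zero_or_pos k with rfl | hk
  · refine ⟨1, _, _, layout_of_forall_isLeaf D (fun w => ?_) ⟨v, hv⟩, rfl⟩
    by_contra hw
    obtain ⟨i, hi, _⟩ := hp.surj w hw
    omega
  · have hv' : (Instance.of D T).IsEnd (⟨v, hv⟩ : Fin m) := by
      refine hend.resolve_right fun h' => h' (p 0) (p 0).2 ?_
      exact (hp.isEnd_iff D hk).2 (Or.inl rfl)
    obtain ⟨i, hi, hiv⟩ := hp.surj _ ((isEnd_iff D _).1 hv').1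
    rw [← hiv, hp.isEnd_iff D hi] at hv'
    have hval : (p i : ℕ) = v := by rw [hiv]
    rcases hv' with rfl | hik
    · obtain ⟨lvl, hl⟩ := hp.layout D hk
      exact ⟨k, _, lvl, hl, hval⟩
    · obtain ⟨lvl, hl⟩ := hp.reverse.layout D hk
      refine ⟨k, _, lvl, hl, ?_⟩
      rw [← hval, show k - 1 - 0 = i by omega]

theorem IsLinear.pos_and_card_le (h : T.IsLinear) : 1 ≤ n ∧ 1 ≤ m ∧ m ≤ 2 * n := by
  obtain ⟨w⟩ := T.isTree.connected.nonempty
  obtain ⟨k, p, hp⟩ := h.exists_isSpine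
  have h1 := hp.length_le
  have h2 := hp.card_le
  have h3 := w.pos
  omega

end BranchDecomposition

/-! ### The input memory -/

theorem inputMemory_small {n m : ℕ} (D : Diagram n) (T : BranchDecomposition (Fin n) (Fin m))
    (hm : m ≤ 2 * n) : (inputMemory D T).Small (2 * n + 1) := by
  have h1 : 2 * n + 1 < 2 ^ (2 * n + 1) := Nat.lt_two_pow_self
  constructor
  · intro i
    simp only [inputMemory]
    split_ifs <;> omega
  · intro a i
    simp only [inputMemory]
    split_ifs <;> omega

theorem inputMemory_holds {n m : ℕ} (D : Diagram n) (T : BranchDecomposition (Fin n) (Fin m)) :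
    (Instance.of D T).Holds (inputMemory D T) := by
  classical
  have key : ∀ {k u v u' v' : ℕ}, v < k → v' < k → u * k + v = u' * k + v' → u = u' ∧ v = v' := by
    intro k u v u' v' hv hv' h
    obtain ⟨k, rfl⟩ : ∃ j, k = j + 1 := ⟨k - 1, by omega⟩
    exact (mul_succ_add_inj (by omega) (by omega)).1 h
  have hadj : ∀ {k : ℕ} (r : Fin k → Fin k → Prop), ∀ u < k, ∀ v < k,
      (∃ i j : Fin k, u * k + v = i * k + j ∧ r i j) ↔
        ∃ i j : Fin k, (i : ℕ) = u ∧ (j : ℕ) = v ∧ r i j := by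
    intro k r u hu v hv
    constructor
    · rintro ⟨i, j, he, hr⟩
      obtain ⟨rfl, rfl⟩ := key hv j.2 he
      exact ⟨i, j, rfl, rfl, hr⟩
    · rintro ⟨i, j, rfl, rfl, hr⟩
      exact ⟨i, j, rfl, hr⟩
  refine ⟨rfl, rfl, ?_, ?_, ?_, ?_⟩
  · intro u hu v hv
    simp only [inputMemory, Instance.of, natMatrix, if_true]
    congr 1
    exact propext (hadj D.graph.Adj u hu v hv)
  · intro u hu v hv
    simp only [inputMemory, Instance.of, natMatrix, if_true, one_ne_zero, if_false]
    congr 1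
    exact propext (hadj T.tree.Adj u hu v hv)
  · intro x hx
    simp [inputMemory, Instance.of]
  · intro x hx
    simp [inputMemory, Instance.of]

end ZX

theorem corollary2 :
    (∀ (n m : ℕ) (D : ZX.Diagram n) (T : ZX.BranchDecomposition (Fin n) (Fin m)),
      T.IsLinear → ∀ v : Fin m, T.nodeWeight D.graph v ≤ T.width D.graph + 1) ∧
    ∃ (P : ZX.Program) (c k : ℕ),
      ∀ (n m : ℕ) (D : ZX.Diagram n) (T : ZX.BranchDecomposition (Fin n) (Fin m)),
        T.IsLinear → P.Contracts D T (c * n ^ k * 2 ^ T.width D.graph) := by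
  -- The program takes `500 * n ^ 3 * 2 ^ R` units of `1000 * (2 * n + 1)` steps, and a unit is at
  -- most `3000 * n` steps because `n ≥ 1`.
  refine ⟨fun n m D T h v => h.nodeWeight_le D.graph v, ZX.Contract.program, 500 * 3000, 4, ?_⟩
  intro n m D T hT
  obtain ⟨hn, hm0, hm⟩ := hT.pos_and_card_le
  obtain ⟨s, t, hr, ht, -, hout⟩ := ZX.Contract.ex_program (I := ZX.Instance.of D T)
    (R := T.width D.graph) hn (ZX.natMatrix_symm fun _ _ h => h.symm)
    (ZX.natMatrix_le_one _) (fun x hx => by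
      have hx : x < n := hx
      simp only [ZX.Instance.of, hx, dif_pos]
      exact (T.leafEquiv ⟨x, hx⟩ : Fin m).2) hm0 hm (hT.exists_layout D)
    (ZX.inputMemory_holds D T)
    (fun i hi => by
      simp [ZX.inputMemory, show i ≠ 0 by omega, show i ≠ 1 by omega])
    (fun a ha => by
      simp [ZX.inputMemory, show a ≠ 0 by omega, show a ≠ 1 by omega, show a ≠ 2 by omega])
    rfl (ZX.inputMemory_small D T hm)
  refine ⟨s, t, hr, hout.trans (D.value_eq T).symm, ht.trans ?_⟩
  change 500 * n ^ 3 * 2 ^ T.width D.graph * (1000 * (2 * n + 1)) ≤ _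
  calc 500 * n ^ 3 * 2 ^ T.width D.graph * (1000 * (2 * n + 1))
      ≤ 500 * n ^ 3 * 2 ^ T.width D.graph * (1000 * (3 * n)) :=
        Nat.mul_le_mul_left _ (by omega)
    _ = _ := by ring
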